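/- Let $n\ge 1$ and let $A(x,\partial_x)=\sum_{i,j=1}^n a_{ij}(x)\partial_i\partial_j+\sum_{i=1}^n b_i(x)\partial_i+c(x)$ be a second order differential operator on $\mathbb R^n$ whose real coefficients are $C^\infty$ with all derivatives (of every order, including zero) bounded on $\mathbb R^n$, and such that the matrix $(a_{ij}(x))$ is symmetric and positive definite for every $x\in\mathbb R^n$. Let $m=\sqrt{n^2-1}/2$, let $\varphi_0,\varphi_1\in C_0^\infty(\mathbb R^n)$ (complex valued), and let $\psi$ be the solution, of class $C^2$ on $\mathbb R^n\times[0,\infty)$, of the Cauchy problem $$\psi_{tt}+n\psi_t-e^{-2t}A(x,\partial_x)\psi+m^2\psi=0,\qquad \psi(x,0)=\varphi_0(x),\quad \psi_t(x,0)=\varphi_1(x).$$ For $\varphi\in C_0^\infty(\mathbb R^n)$ let $V_\varphi$ and $v_\varphi$ be the $C^\infty(\mathbb R^n\times[0,\infty))$ solutions of $u_{tt}-A(x,\partial_x)u=0$ with, respectively, $V_\varphi(x,0)=0$, $\partial_tV_\varphi(x,0)=\varphi(x)$ and $v_\varphi(x,0)=\varphi(x)$, $\partial_tv_\varphi(x,0)=0$.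 For integers $k\ge 0$ put $$V_\varphi^{(k)}(x)=\frac{(-1)^k}{k!}\,\partial_t^kV_\varphi(x,t)\Big|_{t=1},\qquad v_\varphi^{(k)}(x)=\frac{(-1)^k}{k!}\,\partial_t^kv_\varphi(x,t)\Big|_{t=1},$$ and for every integer $N\ge 1$ let $$\psi^{(N)}_{asympt}(x,z)=z^{\frac{n-1}{2}}\left(\sum_{k=0}^{N-1}v_{\varphi_0}^{(k)}(x)z^k+\frac{n-1}{2}\sum_{k=0}^{N-1}V_{\varphi_0}^{(k)}(x)z^k\right)+z^{\frac{n-1}{2}}\sum_{k=0}^{N-1}V_{\varphi_1}^{(k)}(x)z^k .$$ Then for every integer $N\ge 1$ there are constants $C$ and $T$, depending only on $n$, $A$, $N$, $\varphi_0$ and $\varphi_1$, such that $$\|\psi(\cdot,t)-\psi^{(N)}_{asympt}(\cdot,e^{-t})\|_{L^\infty(\mathbb R^n)}\le C\,e^{-Nt-\frac{n-1}{2}t}\qquad\text{for all } t\ge T .$$ -/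

import Mathlib

open scoped ContDiff

namespace DeSitter

/-- `ℝⁿ` with its Euclidean norm. -/
abbrev Space (n : ℕ) : Type := EuclideanSpace ℝ (Fin n)

/-- The partial derivative `∂f/∂xᵢ`. -/
noncomputable def partialDeriv {n : ℕ} (i : Fin n) (f : Space n → ℂ) (x : Space n) : ℂ :=
  fderiv ℝ f x (EuclideanSpace.single i 1)

/-- The space `𝓑^∞` of real `C^∞` functions on `ℝⁿ` all of whose derivatives, of every order
(including order zero), are uniformly bounded. -/
def IsBInfty {n : ℕ} (f : Space n → ℝ) : Prop :=
  ContDiff ℝ ∞ f ∧ ∀ k : ℕ, ∃ C : ℝ, ∀ x, ‖iteratedFDeriv ℝ k f x‖ ≤ C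

/-- The space `C₀^∞(ℝⁿ)` of smooth compactly supported functions. -/
def IsTestFunction {n : ℕ} (φ : Space n → ℂ) : Prop :=
  ContDiff ℝ ∞ φ ∧ HasCompactSupport φ

/-- A second order negative elliptic differential operator
`A(x,∂ₓ) = ∑ᵢⱼ aᵢⱼ(x) ∂ᵢ∂ⱼ + ∑ᵢ bᵢ(x) ∂ᵢ + c(x)` with real coefficients in `𝓑^∞`, the matrix
`(aᵢⱼ(x))` of the leading coefficients being symmetric and positive definite at each point. -/
structure EllipticOperator (n : ℕ) where
  /-- the coefficients of the second order part -/
  a : Space n → Matrix (Fin n) (Fin n) ℝ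
  /-- the coefficients of the first order part -/
  b : Space n → Fin n → ℝ
  /-- the coefficient of order zero -/
  c : Space n → ℝ
  a_mem : ∀ i j, IsBInfty (fun x => a x i j)
  b_mem : ∀ i, IsBInfty (fun x => b x i)
  c_mem : IsBInfty c
  posDef : ∀ x, (a x).PosDef

/-- The action `f ↦ A(x,∂ₓ) f` of the operator on functions. -/
noncomputable def EllipticOperator.apply {n : ℕ} (A : EllipticOperator n)
    (f : Space n → ℂ) (x : Space n) : ℂ :=
  (∑ i, ∑ j, (A.a x i j : ℂ) * partialDeriv i (partialDeriv j f) x)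
    + (∑ i, (A.b x i : ℂ) * partialDeriv i f x)
    + (A.c x : ℂ) * f x

/-- `u = u(x,t)` is a `C^∞(ℝⁿ × [0,∞))` solution of the Cauchy problem
`u_tt - A(x,∂ₓ) u = 0`, `u(x,0) = g₀(x)`, `u_t(x,0) = g₁(x)`. -/
structure IsWaveSolution {n : ℕ} (A : EllipticOperator n) (g₀ g₁ : Space n → ℂ)
    (u : Space n → ℝ → ℂ) : Prop where
  smooth : ContDiffOn ℝ ∞ (fun p : Space n × ℝ => u p.1 p.2) (Set.univ ×ˢ Set.Ici 0)
  equation : ∀ x, ∀ t : ℝ, 0 < t →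
    iteratedDeriv 2 (fun s => u x s) t - A.apply (fun y => u y t) x = 0
  initial_value : ∀ x, u x 0 = g₀ x
  initial_velocity : ∀ x, derivWithin (fun s => u x s) (Set.Ici 0) 0 = g₁ x

/-- `ψ = ψ(x,t)` is a classical, that is `C²(ℝⁿ × [0,∞))`, solution of the Cauchy problem
`ψ_tt + n ψ_t - e^{-2t} A(x,∂ₓ) ψ + m² ψ = 0`, `ψ(x,0) = φ₀(x)`, `ψ_t(x,0) = φ₁(x)`
for the Klein-Gordon equation in the de Sitter space-time. -/
structure IsKleinGordonSolution {n : ℕ} (A : EllipticOperator n) (m : ℝ)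
    (φ₀ φ₁ : Space n → ℂ) (ψ : Space n → ℝ → ℂ) : Prop where
  contDiffOn : ContDiffOn ℝ 2 (fun p : Space n × ℝ => ψ p.1 p.2) (Set.univ ×ˢ Set.Ici 0)
  equation : ∀ x, ∀ t : ℝ, 0 < t →
    iteratedDeriv 2 (fun s => ψ x s) t + (n : ℂ) * deriv (fun s => ψ x s) t
      - (Real.exp (-2 * t) : ℂ) * A.apply (fun y => ψ y t) x + (m : ℂ) ^ 2 * ψ x t = 0
  initial_value : ∀ x, ψ x 0 = φ₀ x
  initial_velocity : ∀ x, derivWithin (fun s => ψ x s) (Set.Ici 0) 0 = φ₁ x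

/-- The coefficient `u^{(k)}(x) = ((-1)^k / k!) (∂/∂t)^k u(x,t)` at `t = 1`. -/
noncomputable def taylorCoeff {n : ℕ} (u : Space n → ℝ → ℂ) (k : ℕ) (x : Space n) : ℂ :=
  (-1) ^ k / (k.factorial : ℂ) * iteratedDeriv k (fun t => u x t) 1

/-- The function `ψ_asympt^{(N)}(x,z)` built from `v₀ = v_{φ₀}`, `V₀ = V_{φ₀}`, `V₁ = V_{φ₁}`
(the power `z^{(n-1)/2}` is taken with its principal branch). -/
noncomputable def psiAsympt {n : ℕ} (v₀ V₀ V₁ : Space n → ℝ → ℂ) (N : ℕ)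
    (x : Space n) (z : ℂ) : ℂ :=
  z ^ (((n : ℂ) - 1) / 2) *
      ((∑ k ∈ Finset.range N, taylorCoeff v₀ k x * z ^ k)
        + ((n : ℂ) - 1) / 2 * ∑ k ∈ Finset.range N, taylorCoeff V₀ k x * z ^ k)
    + z ^ (((n : ℂ) - 1) / 2) * ∑ k ∈ Finset.range N, taylorCoeff V₁ k x * z ^ k

end DeSitter

/-!
In the time `τ = 1 - e⁻ᵗ` the function `u(x,τ) = (1 - τ)^{-(n-1)/2} ψ(x,t)` solves the wave equation
`u_ττ = A u` with data `φ₀` and `φ₁ + (n-1)/2 φ₀`; this is where the value of `m` enters. Waves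
propagate with bounded speed, because a weighted energy of the difference of two of them is monotone
in backward cones. Hence `u` is the superposition of `v_{φ₀}`, `(n-1)/2 V_{φ₀}` and `V_{φ₁}`, whose
support in `x` is bounded for bounded times and which is smooth beyond `τ = 1`. Its Taylor expansion
at `τ = 1`, in powers of `1 - τ = e⁻ᵗ`, is therefore uniform in `x`.
-/

namespace DeSitter

open Set Filter Topology MeasureTheory Matrix

/-! ### Divergence inequalities on space-time slabs -/

/-- The slab `E × [0, T)` of space-time. Time derivatives at the initial time are one-sided. -/
def slab (E : Type*) (T : ℝ) : Set (E × ℝ) := univ ×ˢ Ico 0 T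

theorem slab_mem_nhds {E : Type*} [TopologicalSpace E] {T : ℝ} {p : E × ℝ}
    (hp : p.2 ∈ Ioo 0 T) : slab E T ∈ 𝓝 p :=
  prod_mem_nhds univ_mem (Ico_mem_nhds hp.1 hp.2)

theorem uniqueDiffOn_slab (E : Type*) [NormedAddCommGroup E] [NormedSpace ℝ E] (T : ℝ) :
    UniqueDiffOn ℝ (slab E T) := uniqueDiffOn_univ.prod (uniqueDiffOn_Ico 0 T)

theorem continuous_slice {E F : Type*} [TopologicalSpace E] [TopologicalSpace F] {f : E × ℝ → F}
    {T t : ℝ} (hf : ContinuousOn f (slab E T)) (ht : t ∈ Ico 0 T) : Continuous fun x => f (x, t) :=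
  hf.comp_continuous (.prodMk_left t) fun _ => ⟨mem_univ _, ht⟩

section Divergence

variable {E F : Type*} [NormedAddCommGroup E] [NormedSpace ℝ E]
  [NormedAddCommGroup F] [NormedSpace ℝ F] {T t : ℝ} {k : Set E}

theorem hasFDerivAt_slice_space {f : E × ℝ → F} {x : E} (hf : DifferentiableAt ℝ f (x, t)) :
    HasFDerivAt (fun y => f (y, t)) ((fderiv ℝ f (x, t)).comp (.inl ℝ E ℝ)) x :=
  hf.hasFDerivAt.comp x (hasFDerivAt_prodMk_left x t)

theorem hasDerivAt_slice_time {f : E × ℝ → F} {x : E} (hf : DifferentiableAt ℝ f (x, t)) :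
    HasDerivAt (fun s => f (x, s)) (fderiv ℝ f (x, t) (0, 1)) t :=
  hf.hasFDerivAt.comp_hasDerivAt t ((hasDerivAt_const t x).prodMk (hasDerivAt_id t))

theorem continuous_fderiv_slice {f : E × ℝ → F} (hf : ContDiffOn ℝ 1 f (slab E T))
    (ht : t ∈ Ioo 0 T) : Continuous fun x => fderiv ℝ f (x, t) := by
  refine continuous_iff_continuousAt.2 fun x => ?_
  have h : ContDiffAt ℝ 1 f (x, t) := hf.contDiffAt (slab_mem_nhds ht)
  exact ContinuousAt.comp (f := fun y => (y, t)) (h.continuousAt_fderiv one_ne_zero)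
    (Continuous.prodMk_left t).continuousAt

theorem fderiv_eq_zero_of_slice_eq_zero {f : E × ℝ → F}
    (hk : IsClosed k) (hfk : ∀ x ∉ k, ∀ t ∈ Ico 0 T, f (x, t) = 0) {x : E} (hx : x ∉ k)
    (ht : t ∈ Ioo 0 T) : fderiv ℝ f (x, t) = 0 := by
  have h : f =ᶠ[𝓝 (x, t)] fun _ => 0 := by
    filter_upwards [prod_mem_nhds (hk.isOpen_compl.mem_nhds hx) (Ico_mem_nhds ht.1 ht.2)] with q hq
    exact hfk q.1 hq.1 q.2 hq.2
  rw [h.fderiv_eq, fderiv_fun_const, Pi.zero_apply]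

variable [MeasurableSpace E] [BorelSpace E] {μ : Measure E}

theorem integral_fderiv_apply_eq_zero [FiniteDimensional ℝ E] [μ.IsAddHaarMeasure]
    {f : E → F} (hf : ContDiff ℝ 1 f) (hs : HasCompactSupport f) (v : E) :
    ∫ x, fderiv ℝ f x v ∂μ = 0 := by
  have hf' : Continuous fun x => fderiv ℝ f x v :=
    (hf.continuous_fderiv one_ne_zero).clm_apply continuous_const
  have h := integral_smul_fderiv_eq_neg_fderiv_smul_of_integrable (μ := μ) (v := v)
    (f := fun _ : E => (1 : ℝ)) (g := f) (by simp)
    (by simpa using hf'.integrable_of_hasCompactSupport (hs.fderiv_apply (𝕜 := ℝ) v))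
    (by simpa using hf.continuous.integrable_of_hasCompactSupport hs)
    (fun _ _ => differentiableAt_const _) (fun x _ => hf.differentiable one_ne_zero x)
  simpa using h

theorem integrable_fderiv_apply_slice [IsFiniteMeasureOnCompacts μ] {f : E × ℝ → F}
    (hk : IsCompact k) (hf : ContDiffOn ℝ 1 f (slab E T))
    (hfk : ∀ x ∉ k, ∀ t ∈ Ico 0 T, f (x, t) = 0) (ht : t ∈ Ioo 0 T) (v : E × ℝ) :
    Integrable (fun x => fderiv ℝ f (x, t) v) μ :=
  ((continuous_fderiv_slice hf ht).clm_apply continuous_const).integrable_of_hasCompactSupport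
    (.intro hk fun x hx => by simp [fderiv_eq_zero_of_slice_eq_zero hk.isClosed hfk hx ht])

theorem hasDerivAt_integral_slice [IsFiniteMeasureOnCompacts μ] {f : E × ℝ → F}
    (hk : IsCompact k) (hf : ContDiffOn ℝ 1 f (slab E T))
    (hfk : ∀ x ∉ k, ∀ t ∈ Ico 0 T, f (x, t) = 0) (ht : t ∈ Ioo 0 T) :
    HasDerivAt (fun s => ∫ x, f (x, s) ∂μ) (∫ x, fderiv ℝ f (x, t) (0, 1) ∂μ) t := by
  obtain ⟨a, b, _, hab_nhds, hab⟩ := exists_Icc_mem_subset_of_mem_nhds (Ioo_mem_nhds ht.1 ht.2)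
  have hsub : k ×ˢ Icc a b ⊆ interior (slab E T) := fun p hp =>
    mem_interior_iff_mem_nhds.2 (slab_mem_nhds (hab hp.2))
  have hf' : ContinuousOn (fun p => fderiv ℝ f p (0, 1)) (k ×ˢ Icc a b) :=
    (((hf.mono interior_subset).continuousOn_fderiv_of_isOpen isOpen_interior le_rfl).mono
      hsub).clm_apply continuousOn_const
  obtain ⟨C, hC⟩ := (hk.prod isCompact_Icc).exists_bound_of_continuousOn hf'
  have hint : ∀ s ∈ Ico 0 T, Integrable (fun x => f (x, s)) μ := fun s hs =>
    (continuous_slice hf.continuousOn hs).integrable_of_hasCompactSupport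
      (.intro hk fun x hx => hfk x hx s hs)
  refine (hasDerivAt_integral_of_dominated_loc_of_deriv_le (bound := k.indicator fun _ => C)
    (F' := fun s x => fderiv ℝ f (x, s) (0, 1))
    hab_nhds ?_ (hint t (Ioo_subset_Ico_self ht))
    (integrable_fderiv_apply_slice hk hf hfk ht (0, 1)).aestronglyMeasurable ?_ ?_ ?_).2
  · filter_upwards [hab_nhds] with s hs
    exact (hint s (Ioo_subset_Ico_self (hab hs))).aestronglyMeasurable
  · refine .of_forall fun x s hs => ?_
    by_cases hx : x ∈ k
    · simpa [hx] using hC (x, s) ⟨hx, hs⟩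
    · simp [hx, fderiv_eq_zero_of_slice_eq_zero hk.isClosed hfk hx (hab hs)]
  · exact (integrable_indicator_iff hk.measurableSet).2
      (integrableOn_const (hk.measure_lt_top.ne))
  · exact .of_forall fun x s hs => hasDerivAt_slice_time
      ((hf.differentiableOn one_ne_zero).differentiableAt (slab_mem_nhds (hab hs)))

theorem integral_fderiv_slice_eq_zero [FiniteDimensional ℝ E] [μ.IsAddHaarMeasure] {f : E × ℝ → F}
    (hk : IsCompact k) (hf : ContDiffOn ℝ 1 f (slab E T))
    (hfk : ∀ x ∉ k, ∀ t ∈ Ico 0 T, f (x, t) = 0) (ht : t ∈ Ioo 0 T) (v : E) :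
    ∫ x, fderiv ℝ f (x, t) (v, 0) ∂μ = 0 := by
  have hslice : ContDiff ℝ 1 fun x => f (x, t) := contDiffOn_univ.1 <|
    hf.comp (contDiff_prodMk_left t).contDiffOn
      fun _ _ => ⟨mem_univ _, Ioo_subset_Ico_self ht⟩
  have hderiv : ∀ x, fderiv ℝ (fun y => f (y, t)) x v = fderiv ℝ f (x, t) (v, 0) := fun x => by
    rw [(hasFDerivAt_slice_space
      ((hf.differentiableOn one_ne_zero).differentiableAt (slab_mem_nhds ht))).fderiv]
    simp
  simpa only [hderiv] using integral_fderiv_apply_eq_zero (μ := μ) hslice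
    (.intro hk fun x hx => hfk x hx t (Ioo_subset_Ico_self ht)) v

theorem antitoneOn_integral_of_fderiv_le_divergence [FiniteDimensional ℝ E] [μ.IsAddHaarMeasure]
    {ι : Type*} [Fintype ι] {e : ι → E} {f : E × ℝ → ℝ} {g : ι → E × ℝ → ℝ} (hk : IsCompact k)
    (hf : ContDiffOn ℝ 1 f (slab E T)) (hfk : ∀ x ∉ k, ∀ t ∈ Ico 0 T, f (x, t) = 0)
    (hg : ∀ i, ContDiffOn ℝ 1 (g i) (slab E T))
    (hgk : ∀ i, ∀ x ∉ k, ∀ t ∈ Ico 0 T, g i (x, t) = 0)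
    (h : ∀ x ∈ k, ∀ t ∈ Ioo 0 T,
      fderiv ℝ f (x, t) (0, 1) ≤ ∑ i, fderiv ℝ (g i) (x, t) (e i, 0)) :
    AntitoneOn (fun t => ∫ x, f (x, t) ∂μ) (Ico 0 T) := by
  have h' : ∀ x, ∀ t ∈ Ioo 0 T,
      fderiv ℝ f (x, t) (0, 1) ≤ ∑ i, fderiv ℝ (g i) (x, t) (e i, 0) := fun x t ht => by
    by_cases hx : x ∈ k
    · exact h x hx t ht
    · simp [fderiv_eq_zero_of_slice_eq_zero hk.isClosed hfk hx ht,
        fun i => fderiv_eq_zero_of_slice_eq_zero hk.isClosed (hgk i) hx ht]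
  have hderiv : ∀ t ∈ Ioo 0 T, HasDerivAt (fun s => ∫ x, f (x, s) ∂μ)
      (∫ x, fderiv ℝ f (x, t) (0, 1) ∂μ) t := fun t ht => hasDerivAt_integral_slice hk hf hfk ht
  have hcont : ContinuousOn (fun t => ∫ x, f (x, t) ∂μ) (Ico 0 T) := by
    refine continuousOn_integral_of_compact_support hk ?_ fun t x ht hx => hfk x hx t ht
    exact hf.continuousOn.comp continuous_swap.continuousOn fun p hp => ⟨mem_univ _, hp.1⟩
  refine antitoneOn_of_deriv_nonpos (convex_Ico 0 T) hcont
    (fun t ht => ?_) fun t ht => ?_ <;> rw [interior_Ico] at ht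
  · exact (hderiv t ht).differentiableAt.differentiableWithinAt
  · have hgint : ∀ i, Integrable (fun x => fderiv ℝ (g i) (x, t) (e i, 0)) μ := fun i =>
      integrable_fderiv_apply_slice hk (hg i) (hgk i) ht (e i, 0)
    calc deriv (fun s => ∫ x, f (x, s) ∂μ) t = ∫ x, fderiv ℝ f (x, t) (0, 1) ∂μ :=
          (hderiv t ht).deriv
      _ ≤ ∫ x, ∑ i, fderiv ℝ (g i) (x, t) (e i, 0) ∂μ :=
          integral_mono (integrable_fderiv_apply_slice hk hf hfk ht (0, 1))
            (integrable_finsetSum _ fun i _ => hgint i) fun x => h' x t ht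
      _ = ∑ i, ∫ x, fderiv ℝ (g i) (x, t) (e i, 0) ∂μ := integral_finsetSum _ fun i _ => hgint i
      _ = 0 := Finset.sum_eq_zero fun i _ =>
          integral_fderiv_slice_eq_zero hk (hg i) (hgk i) ht (e i)

theorem eq_zero_of_fderiv_le_divergence [FiniteDimensional ℝ E]
    {ι : Type*} [Fintype ι] {e : ι → E} {f : E × ℝ → ℝ} {g : ι → E × ℝ → ℝ} (hk : IsCompact k)
    (hf : ContDiffOn ℝ 1 f (slab E T)) (hfk : ∀ x ∉ k, ∀ t ∈ Ico 0 T, f (x, t) = 0)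
    (hg : ∀ i, ContDiffOn ℝ 1 (g i) (slab E T))
    (hgk : ∀ i, ∀ x ∉ k, ∀ t ∈ Ico 0 T, g i (x, t) = 0)
    (h : ∀ x ∈ k, ∀ t ∈ Ioo 0 T,
      fderiv ℝ f (x, t) (0, 1) ≤ ∑ i, fderiv ℝ (g i) (x, t) (e i, 0))
    (hf_nonneg : ∀ x, ∀ t ∈ Ico 0 T, 0 ≤ f (x, t)) (hf_zero : ∀ x, f (x, 0) = 0)
    (x : E) (ht : t ∈ Ico 0 T) : f (x, t) = 0 := by
  by_contra hx
  have hpos : 0 < ∫ y, f (y, t) ∂(Measure.addHaar : Measure E) :=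
    (continuous_slice hf.continuousOn ht).integral_pos_of_hasCompactSupport_nonneg_nonzero
      (.intro hk fun y hy => hfk y hy t ht) (fun y => hf_nonneg y t ht) hx
  have hle := antitoneOn_integral_of_fderiv_le_divergence (μ := Measure.addHaar) hk hf hfk hg hgk h
    (left_mem_Ico.2 (ht.1.trans_lt ht.2)) ht ht.1
  simp only [hf_zero, integral_zero] at hle
  exact hpos.not_ge hle

end Divergence

/-! ### Positive definite leading coefficients -/

section PositiveForm

variable {ι : Type*} [Fintype ι]

theorem dotProduct_mulVec_comm_of_isHermitian {a : Matrix ι ι ℝ} (ha : a.IsHermitian)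
    (ξ η : ι → ℝ) : ξ ⬝ᵥ a *ᵥ η = η ⬝ᵥ a *ᵥ ξ := by
  rw [← dotProduct_transpose_mulVec, ← conjTranspose_eq_transpose_of_trivial, ha.eq]

theorem two_mul_mul_dotProduct_mulVec_le {a : Matrix ι ι ℝ} (ha : a.PosSemidef) {K : ℝ}
    (hK : 0 < K) {η : ι → ℝ} (hη : η ⬝ᵥ a *ᵥ η ≤ K ^ 2) (s : ℝ) (ξ : ι → ℝ) :
    2 * s * (η ⬝ᵥ a *ᵥ ξ) ≤ K * (s ^ 2 + ξ ⬝ᵥ a *ᵥ ξ) := by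
  have hsymm := dotProduct_mulVec_comm_of_isHermitian ha.isHermitian ξ η
  have hsq : 0 ≤ K ^ 2 * (ξ ⬝ᵥ a *ᵥ ξ) - K * (2 * s * (η ⬝ᵥ a *ᵥ ξ)) + s ^ 2 * (η ⬝ᵥ a *ᵥ η) := by
    have h := ha.dotProduct_mulVec_nonneg (K • ξ - s • η)
    simp only [star_trivial, mulVec_sub, mulVec_smul, dotProduct_sub, sub_dotProduct,
      dotProduct_smul, smul_dotProduct, smul_eq_mul, hsymm] at h
    linarith
  have hK' : K * (2 * s * (η ⬝ᵥ a *ᵥ ξ)) ≤ K * (K * (s ^ 2 + ξ ⬝ᵥ a *ᵥ ξ)) := by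
    nlinarith [mul_le_mul_of_nonneg_left hη (sq_nonneg s)]
  exact le_of_mul_le_mul_left hK' hK

theorem dotProduct_mulVec_self_le (a : Matrix ι ι ℝ) (η : ι → ℝ) :
    η ⬝ᵥ a *ᵥ η ≤ (∑ i, ∑ j, |a i j|) * (η ⬝ᵥ η) := by
  have hmul : ∀ i j, |η i * η j| ≤ η ⬝ᵥ η := fun i j => by
    have hle : ∀ l, η l ^ 2 ≤ η ⬝ᵥ η := fun l => by
      simpa only [dotProduct, sq] using
        Finset.single_le_sum (fun m _ => mul_self_nonneg (η m)) (Finset.mem_univ l)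
    rw [abs_mul]
    nlinarith [two_mul_le_add_sq |η i| |η j|, hle i, hle j, sq_abs (η i), sq_abs (η j)]
  calc η ⬝ᵥ a *ᵥ η = ∑ i, ∑ j, a i j * (η i * η j) := by
        simp only [dotProduct, mulVec, Finset.mul_sum]
        exact Finset.sum_congr rfl fun i _ => Finset.sum_congr rfl fun j _ => by ring
    _ ≤ ∑ i, ∑ j, |a i j| * (η ⬝ᵥ η) :=
        Finset.sum_le_sum fun i _ => Finset.sum_le_sum fun j _ => (le_abs_self _).trans <|
          (abs_mul _ _).trans_le (mul_le_mul_of_nonneg_left (hmul i j) (abs_nonneg _))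
    _ = (∑ i, ∑ j, |a i j|) * (η ⬝ᵥ η) := by simp only [Finset.sum_mul]

theorem exists_pos_forall_mul_dotProduct_le {X : Type*} [TopologicalSpace X]
    {a : X → Matrix ι ι ℝ} {K : Set X} (hK : IsCompact K) (ha : ContinuousOn a K)
    (hpos : ∀ x ∈ K, (a x).PosDef) :
    ∃ c, 0 < c ∧ ∀ x ∈ K, ∀ ξ, c * (ξ ⬝ᵥ ξ) ≤ ξ ⬝ᵥ a x *ᵥ ξ := by
  have hcont : ContinuousOn (fun q : X × EuclideanSpace ℝ ι => q.2.ofLp ⬝ᵥ a q.1 *ᵥ q.2.ofLp)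
      (K ×ˢ Metric.sphere 0 1) := by
    rw [continuousOn_iff_continuous_domRestrict]
    have ha' : Continuous fun q : K ×ˢ Metric.sphere (0 : EuclideanSpace ℝ ι) 1 => a q.1.1 :=
      ha.comp_continuous (by fun_prop) fun q => q.2.1
    have hη : Continuous fun q : K ×ˢ Metric.sphere (0 : EuclideanSpace ℝ ι) 1 => q.1.2.ofLp := by
      fun_prop
    exact hη.dotProduct (ha'.matrix_mulVec hη)
  obtain ⟨c, hc, hle⟩ := (hK.prod (isCompact_sphere _ _)).exists_forall_le' hcont (a := 0)
    fun q hq => by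
      have hq0 : q.2.ofLp ≠ 0 := by
        simpa using ne_zero_of_mem_unit_sphere ⟨q.2, hq.2⟩
      simpa using (hpos q.1 hq.1).dotProduct_mulVec_pos hq0
  refine ⟨c, hc, fun x hx ξ => ?_⟩
  rcases eq_or_ne ξ 0 with rfl | hξ
  · simp
  set e : EuclideanSpace ℝ ι := WithLp.toLp 2 ξ with he
  have hr : 0 < ‖e‖ := norm_pos_iff.2 (by simpa [he] using hξ)
  have hunit := hle (x, ‖e‖⁻¹ • e) ⟨hx, by simp [norm_smul, hr.ne']⟩
  have hsq : ξ ⬝ᵥ ξ = ‖e‖ ^ 2 := by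
    rw [EuclideanSpace.real_norm_sq_eq]
    simp only [he, dotProduct, sq]
  simp only [WithLp.ofLp_smul, mulVec_smul, dotProduct_smul, smul_dotProduct, smul_eq_mul, he]
    at hunit
  rw [← mul_assoc, ← mul_inv, inv_mul_eq_div, le_div_iff₀ (by positivity)] at hunit
  simpa [hsq, sq] using hunit

end PositiveForm

variable {n : ℕ}

theorem IsBInfty.contDiff_one {f : Space n → ℝ} (hf : IsBInfty f) : ContDiff ℝ 1 f :=
  hf.1.of_le (mod_cast le_top)

theorem IsBInfty.exists_abs_le {f : Space n → ℝ} (hf : IsBInfty f) : ∃ C, ∀ x, |f x| ≤ C := by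
  obtain ⟨C, hC⟩ := hf.2 0
  exact ⟨C, fun x => by simpa using hC x⟩

namespace EllipticOperator

variable (A : EllipticOperator n)

/-- `M` bounds the propagation speed of `u_tt = A u`: the eigenvalues of the principal part are at
most `M ^ 2`. -/
def SpeedLE (M : ℝ) : Prop := ∀ x η, η ⬝ᵥ A.a x *ᵥ η ≤ M ^ 2 * (η ⬝ᵥ η)

theorem exists_speedLE : ∃ M, 0 < M ∧ A.SpeedLE M := by
  choose C hC using fun i j => (A.a_mem i j).exists_abs_le
  have hsum : ∀ x, ∑ i, ∑ j, |A.a x i j| ≤ ∑ i, ∑ j, C i j := fun x =>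
    Finset.sum_le_sum fun i _ => Finset.sum_le_sum fun j _ => hC i j x
  have hsum_nonneg : 0 ≤ ∑ i, ∑ j, C i j := (hsum 0).trans' (by positivity)
  refine ⟨1 + ∑ i, ∑ j, C i j, by positivity, fun x η => (dotProduct_mulVec_self_le _ η).trans ?_⟩
  have hη : 0 ≤ η ⬝ᵥ η := by simpa using dotProduct_star_self_nonneg η
  exact mul_le_mul_of_nonneg_right (by nlinarith [hsum x]) hη

theorem dotProduct_mulVec_self_nonneg (x : Space n) (ξ : Fin n → ℝ) : 0 ≤ ξ ⬝ᵥ A.a x *ᵥ ξ := by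
  simpa using (A.posDef x).posSemidef.dotProduct_mulVec_nonneg ξ

/-- The coefficient of the first order terms left over when the principal part is put in divergence
form: `∑ aᵢⱼ ∂ᵢ∂ⱼ + ∑ bⱼ ∂ⱼ = ∑ ∂ᵢ (aᵢⱼ ∂ⱼ) + ∑ driftⱼ ∂ⱼ`. -/
noncomputable def drift (x : Space n) (j : Fin n) : ℝ :=
  A.b x j - ∑ i, fderiv ℝ (fun y => A.a y i j) x (EuclideanSpace.single i 1)

theorem continuous_drift : Continuous A.drift := by
  refine continuous_pi fun j => (A.b_mem j).1.continuous.sub (continuous_finsetSum _ fun i _ => ?_)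
  exact ((A.a_mem i j).contDiff_one.continuous_fderiv one_ne_zero).clm_apply continuous_const

theorem exists_lower_order_le {K : Set (Space n)} (hK : IsCompact K) :
    ∃ C, ∀ x ∈ K, ∀ (s r : ℝ) (ξ : Fin n → ℝ),
      2 * s * (A.drift x ⬝ᵥ ξ + (A.c x + 1) * r) ≤ C * (s ^ 2 + ξ ⬝ᵥ A.a x *ᵥ ξ + r ^ 2) := by
  have ha : Continuous A.a := continuous_matrix fun i j => (A.a_mem i j).1.continuous
  obtain ⟨c, hc, hell⟩ := exists_pos_forall_mul_dotProduct_le hK ha.continuousOn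
    fun x _ => A.posDef x
  have hlower : Continuous fun x => A.drift x ⬝ᵥ A.drift x + (A.c x + 1) ^ 2 :=
    (A.continuous_drift.dotProduct A.continuous_drift).add
      ((A.c_mem.1.continuous.add continuous_const).pow 2)
  obtain ⟨B, hB⟩ := hK.exists_bound_of_continuousOn hlower.continuousOn
  refine ⟨B + c⁻¹ + 1, fun x hx s r ξ => ?_⟩
  have hcauchy : 2 * s * (A.drift x ⬝ᵥ ξ + (A.c x + 1) * r) ≤
      (A.drift x ⬝ᵥ A.drift x + (A.c x + 1) ^ 2) * s ^ 2 + ξ ⬝ᵥ ξ + r ^ 2 := by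
    have h := dotProduct_star_self_nonneg (s • A.drift x - ξ)
    simp only [star_trivial, dotProduct_sub, sub_dotProduct, dotProduct_smul, smul_dotProduct,
      smul_eq_mul, dotProduct_comm ξ] at h
    nlinarith [sq_nonneg (s * (A.c x + 1) - r)]
  have hξ : ξ ⬝ᵥ ξ ≤ c⁻¹ * (ξ ⬝ᵥ A.a x *ᵥ ξ) := (le_inv_mul_iff₀ hc).2 (hell x hx ξ)
  have hBx : A.drift x ⬝ᵥ A.drift x + (A.c x + 1) ^ 2 ≤ B := (le_abs_self _).trans (hB x hx)
  have hB0 : 0 ≤ B := (norm_nonneg _).trans (hB x hx)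
  have hQ := A.dotProduct_mulVec_self_nonneg x ξ
  have hc' : 0 < c⁻¹ := inv_pos.2 hc
  nlinarith [mul_le_mul_of_nonneg_right hBx (sq_nonneg s), mul_nonneg hB0 hQ,
    mul_nonneg (add_nonneg hB0 hc'.le) (sq_nonneg r), mul_nonneg hc'.le (sq_nonneg s), sq_nonneg s]

end EllipticOperator

/-! ### Energy estimate in backward cones -/

/-- The real first order system satisfied by `u`, `v = u_t` and `w = ∇u` when `u_tt = A u`. -/
structure IsFirstOrderSolution (A : EllipticOperator n) (T : ℝ) (u v : Space n × ℝ → ℝ)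
    (w : Space n × ℝ → Fin n → ℝ) : Prop where
  contDiffOn_u : ContDiffOn ℝ 1 u (slab (Space n) T)
  contDiffOn_v : ContDiffOn ℝ 1 v (slab (Space n) T)
  contDiffOn_w : ContDiffOn ℝ 1 w (slab (Space n) T)
  fderiv_u : ∀ x, ∀ t ∈ Ioo 0 T, fderiv ℝ u (x, t) (0, 1) = v (x, t)
  fderiv_w : ∀ x, ∀ t ∈ Ioo 0 T, ∀ i,
    fderiv ℝ w (x, t) (0, 1) i = fderiv ℝ v (x, t) (EuclideanSpace.single i 1, 0)
  fderiv_v : ∀ x, ∀ t ∈ Ioo 0 T, fderiv ℝ v (x, t) (0, 1) =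
    ∑ i, (A.a x *ᵥ fderiv ℝ w (x, t) (EuclideanSpace.single i 1, 0)) i
      + A.b x ⬝ᵥ w (x, t) + A.c x * u (x, t)

/-- The energy density `v² + ∑ aᵢⱼ wᵢ wⱼ + u²` of the first order system. -/
def energyDensity (A : EllipticOperator n) (u v : Space n × ℝ → ℝ) (w : Space n × ℝ → Fin n → ℝ)
    (p : Space n × ℝ) : ℝ :=
  v p ^ 2 + w p ⬝ᵥ A.a p.1 *ᵥ w p + u p ^ 2

/-- The `i`-th component `2 v ∑ⱼ aᵢⱼ wⱼ` of the energy flux of the first order system. -/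
def energyFlux (A : EllipticOperator n) (v : Space n × ℝ → ℝ) (w : Space n × ℝ → Fin n → ℝ)
    (i : Fin n) (p : Space n × ℝ) : ℝ :=
  2 * v p * (A.a p.1 *ᵥ w p) i

section Energy

variable {A : EllipticOperator n} {T : ℝ} {u v : Space n × ℝ → ℝ} {w : Space n × ℝ → Fin n → ℝ}
  {p : Space n × ℝ}

theorem sq_le_energyDensity (p : Space n × ℝ) : u p ^ 2 ≤ energyDensity A u v w p := by
  unfold energyDensity
  linarith [A.dotProduct_mulVec_self_nonneg p.1 (w p), sq_nonneg (v p)]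

theorem energyDensity_nonneg (p : Space n × ℝ) : 0 ≤ energyDensity A u v w p :=
  (sq_nonneg _).trans (sq_le_energyDensity p)

theorem contDiffOn_coeff_mulVec {s : Set (Space n × ℝ)} (hw : ContDiffOn ℝ 1 w s) (i : Fin n) :
    ContDiffOn ℝ 1 (fun p => (A.a p.1 *ᵥ w p) i) s :=
  ContDiffOn.sum (s := Finset.univ) fun j _ =>
    ((A.a_mem i j).contDiff_one.comp contDiff_fst).contDiffOn.mul (contDiffOn_pi.1 hw j)

theorem IsFirstOrderSolution.contDiffOn_energyDensity (h : IsFirstOrderSolution A T u v w) :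
    ContDiffOn ℝ 1 (energyDensity A u v w) (slab (Space n) T) :=
  ((h.contDiffOn_v.pow 2).add (ContDiffOn.sum fun i _ => (contDiffOn_pi.1 h.contDiffOn_w i).mul
    (contDiffOn_coeff_mulVec h.contDiffOn_w i))).add (h.contDiffOn_u.pow 2)

theorem IsFirstOrderSolution.contDiffOn_energyFlux (h : IsFirstOrderSolution A T u v w)
    (i : Fin n) : ContDiffOn ℝ 1 (energyFlux A v w i) (slab (Space n) T) :=
  (contDiffOn_const.mul h.contDiffOn_v).mul (contDiffOn_coeff_mulVec h.contDiffOn_w i)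

theorem hasFDerivAt_coeff_mulVec (hw : DifferentiableAt ℝ w p) (i : Fin n) :
    HasFDerivAt (fun q : Space n × ℝ => (A.a q.1 *ᵥ w q) i)
      (∑ j, (A.a p.1 i j • (ContinuousLinearMap.proj j).comp (fderiv ℝ w p)
        + w p j • (fderiv ℝ (fun x => A.a x i j) p.1).comp (.fst ℝ (Space n) ℝ))) p := by
  have ha : ∀ j, HasFDerivAt (fun x => A.a x i j) _ p.1 := fun j =>
    ((A.a_mem i j).contDiff_one.differentiable one_ne_zero p.1).hasFDerivAt
  exact .fun_sum (u := Finset.univ) fun j _ =>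
    ((ha j).comp p hasFDerivAt_fst).fun_mul (hasFDerivAt_pi'.1 hw.hasFDerivAt j)

theorem fderiv_energyDensity_time (hu : DifferentiableAt ℝ u p) (hv : DifferentiableAt ℝ v p)
    (hw : DifferentiableAt ℝ w p) :
    fderiv ℝ (energyDensity A u v w) p (0, 1) = 2 * v p * fderiv ℝ v p (0, 1)
      + 2 * (fderiv ℝ w p (0, 1) ⬝ᵥ A.a p.1 *ᵥ w p) + 2 * u p * fderiv ℝ u p (0, 1) := by
  have hquad : HasFDerivAt (fun q => w q ⬝ᵥ A.a q.1 *ᵥ w q) _ p :=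
    .fun_sum (u := Finset.univ) fun i _ => (hasFDerivAt_pi'.1 hw.hasFDerivAt i).fun_mul
      (hasFDerivAt_coeff_mulVec hw i)
  have hE : HasFDerivAt (energyDensity A u v w) _ p :=
    ((hv.hasFDerivAt.pow 2).fun_add hquad).fun_add (hu.hasFDerivAt.pow 2)
  have hsymm := dotProduct_mulVec_comm_of_isHermitian (A.posDef p.1).isHermitian (w p)
    (fderiv ℝ w p (0, 1))
  simp only [dotProduct, mulVec] at hsymm ⊢
  rw [hE.fderiv]
  simp only [Nat.add_one_sub_one, pow_one, nsmul_eq_mul, Nat.cast_ofNat, mul_comm,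
    Finset.sum_add_distrib, smul_add, mulVec, dotProduct, _root_.add_apply, _root_.smul_apply,
    smul_eq_mul, _root_.sum_apply, ContinuousLinearMap.comp_apply, ContinuousLinearMap.proj_apply,
    hsymm, ContinuousLinearMap.coe_fst', map_zero, mul_zero, Finset.sum_const_zero, add_zero]
  ring

theorem fderiv_energyFlux (hv : DifferentiableAt ℝ v p) (hw : DifferentiableAt ℝ w p) (i : Fin n) :
    fderiv ℝ (energyFlux A v w i) p (EuclideanSpace.single i 1, 0) =
      2 * fderiv ℝ v p (EuclideanSpace.single i 1, 0) * (A.a p.1 *ᵥ w p) i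
      + 2 * v p * ((A.a p.1 *ᵥ fderiv ℝ w p (EuclideanSpace.single i 1, 0)) i
        + ∑ j, fderiv ℝ (fun x => A.a x i j) p.1 (EuclideanSpace.single i 1) * w p j) := by
  have hF : HasFDerivAt (energyFlux A v w i) _ p :=
    (hv.hasFDerivAt.const_mul 2).fun_mul (hasFDerivAt_coeff_mulVec hw i)
  rw [hF.fderiv]
  simp only [mul_comm, Finset.sum_add_distrib, smul_add, mulVec, dotProduct, _root_.add_apply,
    _root_.smul_apply, _root_.sum_apply, ContinuousLinearMap.comp_apply,
    ContinuousLinearMap.proj_apply, smul_eq_mul, ContinuousLinearMap.coe_fst']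
  ring

theorem IsFirstOrderSolution.energy_identity (h : IsFirstOrderSolution A T u v w) (x : Space n)
    {t : ℝ} (ht : t ∈ Ioo 0 T) :
    fderiv ℝ (energyDensity A u v w) (x, t) (0, 1)
      - ∑ i, fderiv ℝ (energyFlux A v w i) (x, t) (EuclideanSpace.single i 1, 0)
      = 2 * v (x, t) * (A.drift x ⬝ᵥ w (x, t) + (A.c x + 1) * u (x, t)) := by
  have hn := slab_mem_nhds (p := (x, t)) ht
  have hu := (h.contDiffOn_u.differentiableOn one_ne_zero).differentiableAt hn
  have hv := (h.contDiffOn_v.differentiableOn one_ne_zero).differentiableAt hn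
  have hw := (h.contDiffOn_w.differentiableOn one_ne_zero).differentiableAt hn
  have hwv : ∑ i, 2 * fderiv ℝ v (x, t) (EuclideanSpace.single i 1, 0) * (A.a x *ᵥ w (x, t)) i =
      2 * (fderiv ℝ w (x, t) (0, 1) ⬝ᵥ A.a x *ᵥ w (x, t)) := by
    simp only [dotProduct, Finset.mul_sum, h.fderiv_w x t ht, mul_assoc]
  have hdrift : A.drift x ⬝ᵥ w (x, t) = A.b x ⬝ᵥ w (x, t)
      - ∑ i, ∑ j, fderiv ℝ (fun y => A.a y i j) x (EuclideanSpace.single i 1) * w (x, t) j := by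
    rw [Finset.sum_comm]
    simp only [EllipticOperator.drift, dotProduct, sub_mul, Finset.sum_sub_distrib, Finset.sum_mul]
  simp only [fderiv_energyDensity_time hu hv hw, fderiv_energyFlux hv hw, Finset.sum_add_distrib,
    ← Finset.mul_sum, hwv, hdrift, h.fderiv_u x t ht, h.fderiv_v x t ht]
  ring

end Energy

/-- A `C¹` weight on space-time, positive exactly on the backward cone `‖x - x₀‖ < M (T - t)` as
long as `t ≤ T`; the factor `e^{-lt}` absorbs the lower order terms of the energy identity. -/
noncomputable def coneWeight (x₀ : Space n) (l M T : ℝ) (p : Space n × ℝ) : ℝ :=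
  Real.exp (-l * p.2) * Real.smoothTransition ((M * (T - p.2)) ^ 2 - ‖p.1 - x₀‖ ^ 2)

section ConeWeight

variable {x₀ x : Space n} {l M T t : ℝ}

theorem contDiff_coneWeight : ContDiff ℝ 1 (coneWeight x₀ l M T) := by
  have hcone : ContDiff ℝ 1 fun p : Space n × ℝ => (M * (T - p.2)) ^ 2 - ‖p.1 - x₀‖ ^ 2 :=
    ContDiff.sub (by fun_prop) ((contDiff_fst.sub contDiff_const).norm_sq ℝ)
  exact ContDiff.mul (by fun_prop) ((Real.smoothTransition.contDiff (n := 1)).comp hcone)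

theorem coneWeight_nonneg (p : Space n × ℝ) : 0 ≤ coneWeight x₀ l M T p :=
  mul_nonneg (Real.exp_pos _).le (Real.smoothTransition.nonneg _)

theorem coneWeight_pos (hx : ‖x - x₀‖ < M * (T - t)) : 0 < coneWeight x₀ l M T (x, t) :=
  mul_pos (Real.exp_pos _) (Real.smoothTransition.pos_of_pos
    (sub_pos.2 (pow_lt_pow_left₀ hx (norm_nonneg _) two_ne_zero)))

theorem coneWeight_eq_zero (hMT : 0 ≤ M * (T - t)) (hx : M * (T - t) ≤ ‖x - x₀‖) :
    coneWeight x₀ l M T (x, t) = 0 := by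
  rw [coneWeight, Real.smoothTransition.zero_of_nonpos
    (sub_nonpos.2 (pow_le_pow_left₀ hMT hx 2)), mul_zero]

theorem deriv_smoothTransition_of_neg {s : ℝ} (hs : s < 0) : deriv Real.smoothTransition s = 0 := by
  have h : Real.smoothTransition =ᶠ[𝓝 s] fun _ => 0 := by
    filter_upwards [Iio_mem_nhds hs] with r hr
    exact Real.smoothTransition.zero_of_nonpos (le_of_lt hr)
  rw [h.deriv_eq, deriv_const]

theorem exists_fderiv_coneWeight (hMT : 0 ≤ M * (T - t)) :
    ∃ θ, 0 ≤ θ ∧ (M * (T - t) < ‖x - x₀‖ → θ = 0) ∧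
      fderiv ℝ (coneWeight x₀ l M T) (x, t) (0, 1) =
        -l * coneWeight x₀ l M T (x, t) - 2 * (M * (M * (T - t))) * θ ∧
      ∀ i, fderiv ℝ (coneWeight x₀ l M T) (x, t) (EuclideanSpace.single i 1, 0) =
        -2 * θ * (x - x₀) i := by
  set s := (M * (T - t)) ^ 2 - ‖x - x₀‖ ^ 2 with hs
  have hcone : HasFDerivAt (fun p : Space n × ℝ => (M * (T - p.2)) ^ 2 - ‖p.1 - x₀‖ ^ 2) _ (x, t) :=
    (((hasFDerivAt_snd (𝕜 := ℝ) (p := (x, t))).const_sub T).const_mul M |>.pow 2).fun_sub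
      ((hasFDerivAt_fst (𝕜 := ℝ) (p := (x, t))).sub_const x₀).norm_sq
  have hh : HasDerivAt Real.smoothTransition (deriv Real.smoothTransition s) s :=
    ((Real.smoothTransition.contDiff (n := 1)).differentiable one_ne_zero s).hasDerivAt
  have hexp := ((hasFDerivAt_snd (𝕜 := ℝ) (p := (x, t))).const_mul (-l)).exp
  have hsmooth := hh.comp_hasFDerivAt (x, t) hcone
  have hW : HasFDerivAt (coneWeight x₀ l M T) _ (x, t) := hexp.mul hsmooth
  refine ⟨Real.exp (-l * t) * deriv Real.smoothTransition s,
    mul_nonneg (Real.exp_pos _).le Real.smoothTransition.monotone.deriv_nonneg, fun hx => ?_, ?_,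
    fun i => ?_⟩
  · rw [deriv_smoothTransition_of_neg (sub_neg.2 (pow_lt_pow_left₀ hx hMT two_ne_zero)), mul_zero]
  · rw [hW.fderiv]
    simp only [coneWeight, ← hs, neg_mul, Nat.add_one_sub_one, pow_one, nsmul_eq_mul,
      Nat.cast_ofNat, smul_neg, map_sub, ContinuousLinearMap.sub_comp, neg_smul,
      _root_.add_apply, _root_.smul_apply, _root_.sub_apply, _root_.neg_apply,
      ContinuousLinearMap.coe_snd', smul_eq_mul, mul_one, ContinuousLinearMap.comp_apply,
      ContinuousLinearMap.coe_fst', coe_innerSL_apply, inner_zero_right, sub_self]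
    ring
  · rw [hW.fderiv]
    simp only [neg_mul, Nat.add_one_sub_one, pow_one, nsmul_eq_mul, Nat.cast_ofNat, smul_neg,
      map_sub, ContinuousLinearMap.sub_comp, neg_smul, _root_.add_apply, _root_.smul_apply,
      _root_.sub_apply, _root_.neg_apply, ContinuousLinearMap.coe_snd', smul_eq_mul, mul_zero,
      neg_zero, ContinuousLinearMap.comp_apply, ContinuousLinearMap.coe_fst', coe_innerSL_apply,
      EuclideanSpace.inner_single_right, Real.ringHom_apply, one_mul, zero_sub, mul_neg, add_zero,
      PiLp.sub_apply]
    ring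

theorem fderiv_coneWeight_mul_energy_le {A : EllipticOperator n} (hM : 0 < M) (hA : A.SpeedLE M)
    (u v : Space n × ℝ → ℝ) (w : Space n × ℝ → Fin n → ℝ) (ht : t < T) :
    fderiv ℝ (coneWeight x₀ l M T) (x, t) (0, 1) * energyDensity A u v w (x, t)
      - ∑ i, fderiv ℝ (coneWeight x₀ l M T) (x, t) (EuclideanSpace.single i 1, 0)
          * energyFlux A v w i (x, t)
      ≤ -l * (coneWeight x₀ l M T (x, t) * energyDensity A u v w (x, t)) := by
  have hMT : 0 < M * (T - t) := mul_pos hM (sub_pos.2 ht)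
  obtain ⟨θ, hθ, hθ_zero, htime, hspace⟩ :=
    exists_fderiv_coneWeight (x₀ := x₀) (x := x) (l := l) hMT.le
  have hflux : ∑ i, -2 * θ * (x - x₀) i * energyFlux A v w i (x, t) =
      -2 * θ * (2 * v (x, t) * ((x - x₀).ofLp ⬝ᵥ A.a x *ᵥ w (x, t))) := by
    simp only [energyFlux, dotProduct, Finset.mul_sum]
    exact Finset.sum_congr rfl fun i _ => by ring
  simp only [htime, hspace, hflux]
  rcases lt_or_ge (M * (T - t)) ‖x - x₀‖ with hx | hx
  · simp [hθ_zero hx, mul_assoc]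
  have hspeed : (x - x₀).ofLp ⬝ᵥ A.a x *ᵥ (x - x₀).ofLp ≤ (M * (M * (T - t))) ^ 2 := by
    have hnorm : (x - x₀).ofLp ⬝ᵥ (x - x₀).ofLp = ‖x - x₀‖ ^ 2 := by
      rw [EuclideanSpace.real_norm_sq_eq]
      simp only [dotProduct, sq]
    refine (hA x _).trans ?_
    rw [hnorm, mul_pow M]
    gcongr
  have hvw := two_mul_mul_dotProduct_mulVec_le (A.posDef x).posSemidef (mul_pos hM hMT) hspeed
    (v (x, t)) (w (x, t))
  have hvw' : 2 * v (x, t) * ((x - x₀).ofLp ⬝ᵥ A.a x *ᵥ w (x, t)) ≤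
      M * (M * (T - t)) * energyDensity A u v w (x, t) := by
    refine hvw.trans (mul_le_mul_of_nonneg_left ?_ (mul_pos hM hMT).le)
    exact le_add_of_nonneg_right (sq_nonneg (u (x, t)))
  linarith [mul_le_mul_of_nonneg_left hvw' (mul_nonneg zero_le_two hθ)]

end ConeWeight

section FiniteSpeed

variable {A : EllipticOperator n} {x₀ x : Space n} {M T t : ℝ} {u v : Space n × ℝ → ℝ}
  {w : Space n × ℝ → Fin n → ℝ}

theorem IsFirstOrderSolution.fderiv_weighted_energy_le (h : IsFirstOrderSolution A T u v w)
    (hM : 0 < M) (hA : A.SpeedLE M) {l : ℝ} (ht : t ∈ Ioo 0 T)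
    (hl : ∀ (s r : ℝ) (ξ : Fin n → ℝ),
      2 * s * (A.drift x ⬝ᵥ ξ + (A.c x + 1) * r) ≤ l * (s ^ 2 + ξ ⬝ᵥ A.a x *ᵥ ξ + r ^ 2)) :
    fderiv ℝ (fun p => coneWeight x₀ l M T p * energyDensity A u v w p) (x, t) (0, 1) ≤
      ∑ i, fderiv ℝ (fun p => coneWeight x₀ l M T p * energyFlux A v w i p) (x, t)
        (EuclideanSpace.single i 1, 0) := by
  have hn := slab_mem_nhds (p := (x, t)) ht
  have hW := (contDiff_coneWeight (x₀ := x₀) (l := l) (M := M) (T := T)).differentiable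
    one_ne_zero (x, t)
  have hE := (h.contDiffOn_energyDensity.differentiableOn one_ne_zero).differentiableAt hn
  have hF := fun i => ((h.contDiffOn_energyFlux i).differentiableOn one_ne_zero).differentiableAt hn
  have hcone := fderiv_coneWeight_mul_energy_le (x₀ := x₀) (x := x) (l := l) hM hA u v w ht.2
  have hlower : coneWeight x₀ l M T (x, t)
        * (2 * v (x, t) * (A.drift x ⬝ᵥ w (x, t) + (A.c x + 1) * u (x, t))) ≤
      coneWeight x₀ l M T (x, t) * (l * energyDensity A u v w (x, t)) :=
    mul_le_mul_of_nonneg_left (hl _ _ _) (coneWeight_nonneg _)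
  rw [← h.energy_identity x ht, mul_sub, Finset.mul_sum] at hlower
  rw [fderiv_fun_mul hW hE]
  simp only [fderiv_fun_mul hW (hF _), _root_.add_apply, _root_.smul_apply, smul_eq_mul,
    Finset.sum_add_distrib, mul_comm (energyDensity A u v w (x, t)),
    mul_comm (energyFlux A v w _ (x, t))]
  linarith

theorem IsFirstOrderSolution.eq_zero (h : IsFirstOrderSolution A T u v w) (hM : 0 < M)
    (hA : A.SpeedLE M) (hu : ∀ x ∈ Metric.ball x₀ (M * T), u (x, 0) = 0)
    (hv : ∀ x ∈ Metric.ball x₀ (M * T), v (x, 0) = 0)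
    (hw : ∀ x ∈ Metric.ball x₀ (M * T), w (x, 0) = 0) (ht : t ∈ Ico 0 T)
    (hx : ‖x - x₀‖ < M * (T - t)) : u (x, t) = 0 := by
  have hball : IsCompact (Metric.closedBall x₀ (M * T)) := isCompact_closedBall _ _
  obtain ⟨l, hl⟩ := A.exists_lower_order_le hball
  have hW : ∀ s, ∀ y, s ∈ Ico 0 T → M * T ≤ ‖y - x₀‖ → coneWeight x₀ l M T (y, s) = 0 :=
    fun s y hs hy => coneWeight_eq_zero (mul_nonneg hM.le (sub_nonneg.2 hs.2.le))
      (hy.trans' (mul_le_mul_of_nonneg_left (sub_le_self T hs.1) hM.le))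
  have hW' : ∀ y ∉ Metric.closedBall x₀ (M * T), ∀ s ∈ Ico 0 T, coneWeight x₀ l M T (y, s) = 0 :=
    fun y hy s hs => hW s y hs (by rw [mem_closedBall_iff_norm, not_le] at hy; exact hy.le)
  have hWE : coneWeight x₀ l M T (x, t) * energyDensity A u v w (x, t) = 0 := by
    refine eq_zero_of_fderiv_le_divergence hball (e := fun i => EuclideanSpace.single i 1)
      (f := fun p => coneWeight x₀ l M T p * energyDensity A u v w p)
      (g := fun i p => coneWeight x₀ l M T p * energyFlux A v w i p)
      (contDiff_coneWeight.contDiffOn.mul h.contDiffOn_energyDensity)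
      (fun y hy s hs => by simp only [hW' y hy s hs, zero_mul])
      (fun i => contDiff_coneWeight.contDiffOn.mul (h.contDiffOn_energyFlux i))
      (fun i y hy s hs => by simp only [hW' y hy s hs, zero_mul])
      (fun y hy s hs => h.fderiv_weighted_energy_le hM hA hs (hl y hy))
      (fun y s _ => mul_nonneg (coneWeight_nonneg _) (energyDensity_nonneg _))
      (fun y => ?_) x ht
    rcases lt_or_ge ‖y - x₀‖ (M * T) with hy | hy
    · rw [← mem_ball_iff_norm] at hy
      simp [energyDensity, hu y hy, hv y hy, hw y hy]
    · rw [hW 0 y ⟨le_rfl, ht.1.trans_lt ht.2⟩ hy, zero_mul]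
  have hE : energyDensity A u v w (x, t) = 0 :=
    (mul_eq_zero.1 hWE).resolve_left (coneWeight_pos hx).ne'
  exact pow_eq_zero_iff two_ne_zero |>.1
    (((sq_le_energyDensity (x, t)).trans hE.le).antisymm (sq_nonneg _))

end FiniteSpeed

/-! ### Space and time slices -/

section Slices

variable {E F : Type*} [NormedAddCommGroup E] [NormedSpace ℝ E] [NormedAddCommGroup F]
  [NormedSpace ℝ F] {x : E} {t : ℝ}

theorem hasFDerivAt_fderiv_apply {f : E → F} (hf : ContDiffAt ℝ 2 f x) (e : E) :
    HasFDerivAt (fun y => fderiv ℝ f y e) ((fderiv ℝ (fderiv ℝ f) x).flip e) x := by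
  have h : DifferentiableAt ℝ (fderiv ℝ f) x :=
    (hf.fderiv_right (m := 1) (by norm_num)).differentiableAt one_ne_zero
  exact (h.hasFDerivAt.clm_apply (hasFDerivAt_const e x)).congr_fderiv (by ext; simp)

theorem eventually_differentiableAt {f : E → F} (hf : ContDiffAt ℝ 2 f x) :
    ∀ᶠ y in 𝓝 x, DifferentiableAt ℝ f y :=
  (hf.eventually (by simp)).mono fun _ hy => hy.differentiableAt two_ne_zero

theorem iteratedDeriv_two_slice {f : E × ℝ → F} (hf : ContDiffAt ℝ 2 f (x, t)) :
    iteratedDeriv 2 (fun s => f (x, s)) t = fderiv ℝ (fderiv ℝ f) (x, t) (0, 1) (0, 1) := by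
  have h : deriv (fun s => f (x, s)) =ᶠ[𝓝 t] fun s => fderiv ℝ f (x, s) (0, 1) := by
    filter_upwards [(Continuous.prodMk_right x).continuousAt.eventually
      (eventually_differentiableAt hf)] with s hs
    exact (hasDerivAt_slice_time hs).deriv
  have h' := hasFDerivAt_fderiv_apply hf (0, 1)
  rw [iteratedDeriv_succ, iteratedDeriv_one, h.deriv_eq,
    (hasDerivAt_slice_time h'.differentiableAt).deriv, h'.fderiv, ContinuousLinearMap.flip_apply]

end Slices

section Partial

variable {f : Space n × ℝ → ℂ} {g h : Space n → ℂ} {x : Space n} {t : ℝ}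

theorem partialDeriv_slice (hf : DifferentiableAt ℝ f (x, t)) (i : Fin n) :
    partialDeriv i (fun y => f (y, t)) x = fderiv ℝ f (x, t) (EuclideanSpace.single i 1, 0) := by
  rw [partialDeriv, (hasFDerivAt_slice_space hf).fderiv]
  simp

theorem partialDeriv_partialDeriv_slice (hf : ContDiffAt ℝ 2 f (x, t)) (i j : Fin n) :
    partialDeriv i (partialDeriv j fun y => f (y, t)) x =
      fderiv ℝ (fderiv ℝ f) (x, t) (EuclideanSpace.single i 1, 0)
        (EuclideanSpace.single j 1, 0) := by
  have h : partialDeriv j (fun y => f (y, t)) =ᶠ[𝓝 x]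
      fun y => fderiv ℝ f (y, t) (EuclideanSpace.single j 1, 0) := by
    filter_upwards [(Continuous.prodMk_left t).continuousAt.eventually
      (eventually_differentiableAt hf)] with y hy
    exact partialDeriv_slice hy j
  have h' := hasFDerivAt_fderiv_apply hf (EuclideanSpace.single j 1, 0)
  rw [partialDeriv, h.fderiv_eq, ← partialDeriv, partialDeriv_slice h'.differentiableAt, h'.fderiv,
    ContinuousLinearMap.flip_apply]

theorem EllipticOperator.apply_slice (A : EllipticOperator n) (hf : ContDiffAt ℝ 2 f (x, t)) :
    A.apply (fun y => f (y, t)) x =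
      (∑ i, ∑ j, (A.a x i j : ℂ) * fderiv ℝ (fderiv ℝ f) (x, t) (EuclideanSpace.single i 1, 0)
        (EuclideanSpace.single j 1, 0))
      + (∑ i, (A.b x i : ℂ) * fderiv ℝ f (x, t) (EuclideanSpace.single i 1, 0))
      + (A.c x : ℂ) * f (x, t) := by
  simp only [EllipticOperator.apply, partialDeriv_partialDeriv_slice hf,
    partialDeriv_slice (hf.differentiableAt two_ne_zero)]

theorem partialDeriv_add (hg : DifferentiableAt ℝ g x) (hh : DifferentiableAt ℝ h x) (i : Fin n) :
    partialDeriv i (g + h) x = partialDeriv i g x + partialDeriv i h x := by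
  simp only [partialDeriv, fderiv_add hg hh, _root_.add_apply]

theorem partialDeriv_partialDeriv_add (hg : ContDiffAt ℝ 2 g x) (hh : ContDiffAt ℝ 2 h x)
    (i j : Fin n) : partialDeriv i (partialDeriv j (g + h)) x =
      partialDeriv i (partialDeriv j g) x + partialDeriv i (partialDeriv j h) x := by
  have hsum : partialDeriv j (g + h) =ᶠ[𝓝 x] partialDeriv j g + partialDeriv j h := by
    filter_upwards [eventually_differentiableAt hg, eventually_differentiableAt hh] with y hg' hh'
    exact partialDeriv_add hg' hh' j
  rw [partialDeriv, hsum.fderiv_eq, ← partialDeriv]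
  exact partialDeriv_add (hasFDerivAt_fderiv_apply hg _).differentiableAt
    (hasFDerivAt_fderiv_apply hh _).differentiableAt i

theorem EllipticOperator.apply_add (A : EllipticOperator n) (hg : ContDiffAt ℝ 2 g x)
    (hh : ContDiffAt ℝ 2 h x) : A.apply (g + h) x = A.apply g x + A.apply h x := by
  simp only [EllipticOperator.apply, partialDeriv_partialDeriv_add hg hh, Pi.add_apply,
    partialDeriv_add (hg.differentiableAt two_ne_zero) (hh.differentiableAt two_ne_zero), mul_add,
    Finset.sum_add_distrib]
  ring

variable {R : Type*} [DivisionRing R] [Module R ℂ] [SMulCommClass ℝ R ℂ] [ContinuousConstSMul R ℂ]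

theorem partialDeriv_const_smul (c : R) (g : Space n → ℂ) (i : Fin n) :
    partialDeriv i (c • g) = c • partialDeriv i g := by
  funext y
  simp only [partialDeriv, fderiv_const_smul_field, Pi.smul_apply, _root_.smul_apply]

theorem EllipticOperator.apply_const_smul [SMulCommClass R ℂ ℂ] (A : EllipticOperator n) (c : R)
    (g : Space n → ℂ) : A.apply (c • g) = c • A.apply g := by
  funext y
  simp only [EllipticOperator.apply, partialDeriv_const_smul, Pi.smul_apply, smul_add,
    Finset.smul_sum, mul_smul_comm]

end Partial

/-! ### The Cauchy problem for the wave equation -/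

/-- `u` is a solution of class `C^r` of `u_tt = A u` on `ℝⁿ × [0, T)` with `u(x,0) = g₀(x)` and
`u_t(x,0) = g₁(x)`. -/
structure IsWaveOn (A : EllipticOperator n) (r : WithTop ℕ∞) (T : ℝ) (g₀ g₁ : Space n → ℂ)
    (u : Space n → ℝ → ℂ) : Prop where
  contDiffOn : ContDiffOn ℝ r (fun p : Space n × ℝ => u p.1 p.2) (slab (Space n) T)
  equation : ∀ x, ∀ t ∈ Ioo 0 T, iteratedDeriv 2 (u x) t = A.apply (fun y => u y t) x
  value : ∀ x, u x 0 = g₀ x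
  velocity : ∀ x, HasDerivWithinAt (u x) (g₁ x) (Ici 0) 0

namespace IsWaveOn

variable {A : EllipticOperator n} {r r' : WithTop ℕ∞} {T T' t : ℝ} {g₀ g₁ h₀ h₁ : Space n → ℂ}
  {u v : Space n → ℝ → ℂ}

theorem mono (hu : IsWaveOn A r T g₀ g₁ u) (hr : r' ≤ r) (hT : T' ≤ T) :
    IsWaveOn A r' T' g₀ g₁ u where
  contDiffOn := (hu.contDiffOn.of_le hr).mono (prod_mono_right (Ico_subset_Ico_right hT))
  equation x t ht := hu.equation x t ⟨ht.1, ht.2.trans_le hT⟩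
  value := hu.value
  velocity := hu.velocity

theorem contDiffAt (hu : IsWaveOn A r T g₀ g₁ u) (x : Space n) (ht : t ∈ Ioo 0 T) :
    ContDiffAt ℝ r (fun p : Space n × ℝ => u p.1 p.2) (x, t) :=
  hu.contDiffOn.contDiffAt (slab_mem_nhds ht)

theorem contDiffAt_time (hu : IsWaveOn A r T g₀ g₁ u) (x : Space n) (ht : t ∈ Ioo 0 T) :
    ContDiffAt ℝ r (u x) t :=
  (hu.contDiffAt x ht).comp t (contDiffAt_const.prodMk contDiffAt_id)

theorem contDiffAt_space (hu : IsWaveOn A r T g₀ g₁ u) (x : Space n) (ht : t ∈ Ioo 0 T) :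
    ContDiffAt ℝ r (fun y => u y t) x :=
  (hu.contDiffAt x ht).comp x (contDiffAt_id.prodMk contDiffAt_const)

theorem add (hr : 2 ≤ r) (hu : IsWaveOn A r T g₀ g₁ u) (hv : IsWaveOn A r T h₀ h₁ v) :
    IsWaveOn A r T (g₀ + h₀) (g₁ + h₁) (u + v) where
  contDiffOn := hu.contDiffOn.add hv.contDiffOn
  equation x t ht := by
    have happly := A.apply_add ((hu.contDiffAt_space x ht).of_le hr)
      ((hv.contDiffAt_space x ht).of_le hr)
    rw [← hu.equation x t ht, ← hv.equation x t ht] at happly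
    exact (iteratedDeriv_add ((hu.contDiffAt_time x ht).of_le hr)
      ((hv.contDiffAt_time x ht).of_le hr)).trans happly.symm
  value x := congrArg₂ (· + ·) (hu.value x) (hv.value x)
  velocity x := (hu.velocity x).add (hv.velocity x)

theorem const_smul {R : Type*} [DivisionRing R] [Module R ℂ] [SMulCommClass ℝ R ℂ]
    [ContinuousConstSMul R ℂ] [SMulCommClass R ℂ ℂ] (hu : IsWaveOn A r T g₀ g₁ u) (c : R) :
    IsWaveOn A r T (c • g₀) (c • g₁) (c • u) where
  contDiffOn := hu.contDiffOn.const_smul c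
  equation x t ht := by
    have happly := congrFun (A.apply_const_smul c fun y => u y t) x
    rw [Pi.smul_apply, ← hu.equation x t ht] at happly
    exact (iteratedDeriv_const_smul_field c (u x)).trans happly.symm
  value x := congrArg (c • ·) (hu.value x)
  velocity x := (hu.velocity x).const_smul c

end IsWaveOn

/-! ### Finite speed of propagation -/

section FirstOrderSystem

variable {E F : Type*} [NormedAddCommGroup E] [NormedSpace ℝ E] [NormedAddCommGroup F]
  [NormedSpace ℝ F] {f : E × ℝ → F} {x : E} {t T : ℝ}

theorem fderivWithin_slab_eventuallyEq (ht : t ∈ Ioo 0 T) :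
    fderivWithin ℝ f (slab E T) =ᶠ[𝓝 (x, t)] fderiv ℝ f := by
  filter_upwards [prod_mem_nhds univ_mem (Ioo_mem_nhds ht.1 ht.2)] with q hq
  exact fderivWithin_of_mem_nhds (slab_mem_nhds hq.2)

theorem hasFDerivAt_clm_fderivWithin_slab_apply (hf : ContDiffOn ℝ 2 f (slab E T))
    (L : F →L[ℝ] ℝ) (ht : t ∈ Ioo 0 T) (e : E × ℝ) :
    HasFDerivAt (fun q => L (fderivWithin ℝ f (slab E T) q e))
      (L.comp ((fderiv ℝ (fderiv ℝ f) (x, t)).flip e)) (x, t) :=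
  have hL := L.hasFDerivAt.comp (x, t)
    (hasFDerivAt_fderiv_apply (hf.contDiffAt (slab_mem_nhds ht)) e)
  hL.congr_of_eventuallyEq <|
    (fderivWithin_slab_eventuallyEq (f := f) ht).mono fun q hq => by simp [hq]

end FirstOrderSystem

namespace IsWaveOn

variable {A : EllipticOperator n} {T t M : ℝ} {g₀ g₁ : Space n → ℂ}
  {u v : Space n → ℝ → ℂ} {x x₀ : Space n}

theorem isFirstOrderSolution (hu : IsWaveOn A 2 T g₀ g₁ u) (L : ℂ →L[ℝ] ℝ) :
    IsFirstOrderSolution A T (fun p => L (u p.1 p.2))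
      (fun p => L (fderivWithin ℝ (fun p => u p.1 p.2) (slab (Space n) T) p (0, 1)))
      (fun p i => L (fderivWithin ℝ (fun p => u p.1 p.2) (slab (Space n) T) p
        (EuclideanSpace.single i 1, 0))) := by
  have hD : ContDiffOn ℝ 1 (fderivWithin ℝ (fun p : Space n × ℝ => u p.1 p.2) (slab (Space n) T))
      (slab (Space n) T) := hu.contDiffOn.fderivWithin (uniqueDiffOn_slab _ T) (by norm_num)
  have hlocal := fun x t (ht : t ∈ Ioo 0 T) e =>
    hasFDerivAt_clm_fderivWithin_slab_apply (x := x) hu.contDiffOn L ht e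
  have hgrad := fun x t (ht : t ∈ Ioo 0 T) =>
    hasFDerivAt_pi.2 fun i => hlocal x t ht (EuclideanSpace.single i 1, 0)
  have hL : ∀ (r : ℝ) (z : ℂ), L (r * z) = r * L z := fun r z => by
    rw [← Complex.real_smul, map_smul, smul_eq_mul]
  refine ⟨L.contDiff.comp_contDiffOn (hu.contDiffOn.of_le one_le_two),
    L.contDiff.comp_contDiffOn (hD.clm_apply contDiffOn_const),
    contDiffOn_pi.2 fun i => L.contDiff.comp_contDiffOn (hD.clm_apply contDiffOn_const),
    fun x t ht => ?_, fun x t ht i => ?_, fun x t ht => ?_⟩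
  · have hux := (hu.contDiffAt x ht).differentiableAt two_ne_zero
    rw [fderivWithin_of_mem_nhds (slab_mem_nhds ht)]
    exact congrArg (· (0, 1)) (L.hasFDerivAt.comp (x, t) hux.hasFDerivAt).fderiv
  · rw [(hgrad x t ht).fderiv, (hlocal x t ht _).fderiv]
    exact congrArg L (((hu.contDiffAt x ht).isSymmSndFDerivAt (by simp)).eq _ _)
  · have hwave := hu.equation x t ht
    rw [A.apply_slice (hu.contDiffAt x ht)] at hwave
    have htime := iteratedDeriv_two_slice (hu.contDiffAt x ht)
    rw [(hlocal x t ht _).fderiv, (hgrad x t ht).fderiv]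
    simp only [fderivWithin_of_mem_nhds (slab_mem_nhds (p := (x, t)) ht)]
    refine (congrArg L (htime.symm.trans hwave)).trans ?_
    simp [hL, mulVec, dotProduct]

theorem fderivWithin_time (hu : IsWaveOn A 2 T g₀ g₁ u) (hT : 0 < T) (x : Space n) :
    fderivWithin ℝ (fun p : Space n × ℝ => u p.1 p.2) (slab (Space n) T) (x, 0) (0, 1) = g₁ x := by
  have hD := (hu.contDiffOn.differentiableOn two_ne_zero (x, 0)
    ⟨mem_univ _, le_rfl, hT⟩).hasFDerivWithinAt
  exact (uniqueDiffOn_Ico 0 T 0 ⟨le_rfl, hT⟩).eq_deriv _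
    (hD.comp_hasDerivWithinAt (0 : ℝ)
      ((hasDerivWithinAt_const 0 _ x).prodMk (hasDerivWithinAt_id 0 _))
      fun s hs => ⟨mem_univ _, hs⟩)
    ((hu.velocity x).mono Ico_subset_Ici_self)

theorem fderivWithin_space (hu : IsWaveOn A 2 T g₀ g₁ u) (hT : 0 < T) (x e : Space n) :
    fderivWithin ℝ (fun p : Space n × ℝ => u p.1 p.2) (slab (Space n) T) (x, 0) (e, 0) =
      fderiv ℝ g₀ x e := by
  have hmem : ∀ y : Space n, (y, (0 : ℝ)) ∈ slab (Space n) T := fun y => ⟨mem_univ _, le_rfl, hT⟩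
  have hD := (hu.contDiffOn.differentiableOn two_ne_zero (x, 0) (hmem x)).hasFDerivWithinAt
  have hslice := hasFDerivWithinAt_univ.1 <|
    hD.comp x (hasFDerivAt_prodMk_left x (0 : ℝ)).hasFDerivWithinAt fun y _ => hmem y
  rw [(hslice.congr_of_eventuallyEq (.of_forall fun y => (hu.value y).symm)).fderiv]
  simp

theorem eq_zero (hu : IsWaveOn A 2 T g₀ g₁ u) (hM : 0 < M) (hA : A.SpeedLE M)
    (h₀ : ∀ y ∈ Metric.ball x₀ (M * T), g₀ y = 0) (h₁ : ∀ y ∈ Metric.ball x₀ (M * T), g₁ y = 0)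
    (ht : t ∈ Ico 0 T) (hx : ‖x - x₀‖ < M * (T - t)) : u x t = 0 := by
  have hT : 0 < T := ht.1.trans_lt ht.2
  have hgrad : ∀ y ∈ Metric.ball x₀ (M * T), fderiv ℝ g₀ y = 0 := fun y hy => by
    have h : g₀ =ᶠ[𝓝 y] fun _ => 0 := by
      filter_upwards [Metric.isOpen_ball.mem_nhds hy] using h₀
    rw [h.fderiv_eq, fderiv_fun_const, Pi.zero_apply]
  have hcomponent : ∀ L : ℂ →L[ℝ] ℝ, L (u x t) = 0 := fun L =>
    (hu.isFirstOrderSolution L).eq_zero hM hA (fun y hy => by simp [hu.value, h₀ y hy])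
      (fun y hy => by simp [hu.fderivWithin_time hT, h₁ y hy])
      (fun y hy => by ext i; simp [hu.fderivWithin_space hT, hgrad y hy]) ht hx
  exact Complex.ext (hcomponent Complex.reCLM) (hcomponent Complex.imCLM)

theorem unique (hu : IsWaveOn A 2 T g₀ g₁ u) (hv : IsWaveOn A 2 T g₀ g₁ v) (x : Space n)
    (ht : t ∈ Ico 0 T) : u x t = v x t := by
  obtain ⟨M, hM, hA⟩ := A.exists_speedLE
  have h := (hu.add le_rfl (hv.const_smul (-1 : ℝ))).eq_zero hM hA (x₀ := x) (x := x) (by simp)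
    (by simp) ht (by simpa using mul_pos hM (sub_pos.2 ht.2))
  simpa [add_neg_eq_zero] using h

theorem exists_forall_eq_zero_of_lt_norm (hu : IsWaveOn A 2 T g₀ g₁ u) (h₀ : HasCompactSupport g₀)
    (h₁ : HasCompactSupport g₁) : ∃ R, ∀ x, R < ‖x‖ → ∀ t ∈ Ico 0 T, u x t = 0 := by
  obtain ⟨M, hM, hA⟩ := A.exists_speedLE
  obtain ⟨R, hR⟩ := (h₀.isCompact.union h₁.isCompact).isBounded.subset_closedBall (0 : Space n)
  refine ⟨R + M * T, fun x hx t ht => ?_⟩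
  have hdisjoint : ∀ y ∈ Metric.ball x (M * T), y ∉ tsupport g₀ ∪ tsupport g₁ := fun y hy hys => by
    have hyR : ‖y‖ ≤ R := by simpa using hR hys
    rw [mem_ball_iff_norm'] at hy
    linarith [norm_sub_norm_le x y]
  refine hu.eq_zero hM hA (x₀ := x)
    (fun y hy => image_eq_zero_of_notMem_tsupport fun h => hdisjoint y hy (Or.inl h))
    (fun y hy => image_eq_zero_of_notMem_tsupport fun h => hdisjoint y hy (Or.inr h)) ht ?_
  simpa using mul_pos hM (sub_pos.2 ht.2)

end IsWaveOn

/-! ### The conformal change of time -/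

section ConformalTime

variable {F : Type*} [NormedAddCommGroup F] [NormedSpace ℝ F] {g : ℝ → F} {g' : F} {τ : ℝ}

theorem neg_log_one_sub_nonneg (hτ : τ ∈ Ico 0 1) : 0 ≤ -Real.log (1 - τ) :=
  neg_nonneg.2 (Real.log_nonpos (sub_pos.2 hτ.2).le (sub_le_self 1 hτ.1))

theorem neg_log_one_sub_pos (hτ : τ ∈ Ioo 0 1) : 0 < -Real.log (1 - τ) :=
  neg_pos.2 (Real.log_neg (sub_pos.2 hτ.2) (sub_lt_self 1 hτ.1))

theorem hasDerivWithinAt_rpow_smul_comp_log {s r : Set ℝ} (α : ℝ) (hτ : τ < 1)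
    (hg : HasDerivWithinAt g g' r (-Real.log (1 - τ)))
    (hs : MapsTo (fun σ => -Real.log (1 - σ)) s r) :
    HasDerivWithinAt (fun σ => (1 - σ) ^ α • g (-Real.log (1 - σ)))
      ((1 - τ) ^ (α - 1) • (g' - α • g (-Real.log (1 - τ)))) s τ := by
  have hne : 1 - τ ≠ 0 := (sub_pos.2 hτ).ne'
  have hsub : HasDerivAt (fun σ : ℝ => 1 - σ) (-1) τ := (hasDerivAt_id τ).const_sub 1
  have hpow := hsub.rpow_const (p := α) (Or.inl hne)
  have hlog : HasDerivAt (fun σ : ℝ => -Real.log (1 - σ)) _ τ := (hsub.log hne).neg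
  have hprod := hpow.hasDerivWithinAt.fun_smul (hg.scomp τ hlog.hasDerivWithinAt hs)
  refine hprod.congr_deriv ?_
  have hα : (1 - τ) ^ α * -(-1 / (1 - τ)) = (1 - τ) ^ (α - 1) := by
    rw [Real.rpow_sub_one hne]
    ring
  rw [smul_smul, hα, Function.comp_apply]
  module

theorem hasDerivAt_rpow_smul_comp_log (α : ℝ) (hτ : τ < 1)
    (hg : HasDerivAt g g' (-Real.log (1 - τ))) :
    HasDerivAt (fun σ => (1 - σ) ^ α • g (-Real.log (1 - σ)))
      ((1 - τ) ^ (α - 1) • (g' - α • g (-Real.log (1 - τ)))) τ := by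
  rw [← hasDerivWithinAt_univ] at hg ⊢
  exact hasDerivWithinAt_rpow_smul_comp_log α hτ hg (mapsTo_univ _ _)

theorem iteratedDeriv_two_rpow_smul_comp_log (κ : ℝ) (hτ : τ < 1)
    (hg : ContDiffAt ℝ 2 g (-Real.log (1 - τ))) :
    iteratedDeriv 2 (fun σ => (1 - σ) ^ (-κ) • g (-Real.log (1 - σ))) τ =
      (1 - τ) ^ (-κ - 2) • (iteratedDeriv 2 g (-Real.log (1 - τ))
        + (2 * κ + 1) • deriv g (-Real.log (1 - τ)) + (κ * (κ + 1)) • g (-Real.log (1 - τ))) := by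
  have hcont : ContinuousAt (fun σ : ℝ => -Real.log (1 - σ)) τ :=
    (continuousAt_const.sub continuousAt_id).log (sub_pos.2 hτ).ne' |>.neg
  have hderiv : deriv (fun σ => (1 - σ) ^ (-κ) • g (-Real.log (1 - σ))) =ᶠ[𝓝 τ]
      fun σ => (1 - σ) ^ (-κ - 1) • (fun s => deriv g s + κ • g s) (-Real.log (1 - σ)) := by
    filter_upwards [Iio_mem_nhds hτ, hcont.eventually (eventually_differentiableAt hg)]
      with σ hσ hgσ
    rw [(hasDerivAt_rpow_smul_comp_log (-κ) hσ hgσ.hasDerivAt).deriv, neg_smul, sub_neg_eq_add]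
  have hg' : HasDerivAt (deriv g) (deriv (deriv g) (-Real.log (1 - τ))) (-Real.log (1 - τ)) :=
    (hasFDerivAt_fderiv_apply hg 1).differentiableAt.hasDerivAt
  have hderiv₂ := hasDerivAt_rpow_smul_comp_log (-κ - 1) hτ
    (hg'.fun_add ((hg.differentiableAt two_ne_zero).hasDerivAt.fun_const_smul κ))
  simp only [iteratedDeriv_succ, iteratedDeriv_zero]
  rw [hderiv.deriv_eq, hderiv₂.deriv, sub_sub, one_add_one_eq_two]
  module

end ConformalTime

/-- The function `u(x,τ) = (1 - τ)^{-κ} ψ(x,t)` of the new time `τ = 1 - e^{-t}`. For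
`κ = (n - 1) / 2` it solves the wave equation if `ψ` solves the Klein-Gordon equation. -/
noncomputable def conformalTransform (κ : ℝ) (ψ : Space n → ℝ → ℂ) (x : Space n) (τ : ℝ) : ℂ :=
  (1 - τ) ^ (-κ) • ψ x (-Real.log (1 - τ))

theorem hasDerivWithinAt_slice_zero {E F : Type*} [NormedAddCommGroup E] [NormedSpace ℝ E]
    [NormedAddCommGroup F] [NormedSpace ℝ F] {u : E → ℝ → F}
    (hu : DifferentiableOn ℝ (fun p : E × ℝ => u p.1 p.2) (univ ×ˢ Ici 0)) (x : E) :
    HasDerivWithinAt (u x) (derivWithin (u x) (Ici 0) 0) (Ici 0) 0 :=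
  ((hu (x, 0) ⟨mem_univ _, self_mem_Ici⟩).comp (0 : ℝ)
    ((differentiableWithinAt_const x).prodMk differentiableWithinAt_id)
    fun _ hs => ⟨mem_univ _, hs⟩).hasDerivWithinAt

section KleinGordon

variable {A : EllipticOperator n} {m κ : ℝ} {φ₀ φ₁ : Space n → ℂ} {ψ u : Space n → ℝ → ℂ}

theorem IsKleinGordonSolution.contDiffOn_conformalTransform
    (hψ : IsKleinGordonSolution A m φ₀ φ₁ ψ) (κ : ℝ) :
    ContDiffOn ℝ 2 (fun p : Space n × ℝ => conformalTransform κ ψ p.1 p.2) (slab (Space n) 1) := by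
  have hne : ∀ p ∈ slab (Space n) 1, 1 - p.2 ≠ 0 := fun p hp => (sub_pos.2 hp.2.2).ne'
  have hsub : ContDiffOn ℝ 2 (fun p : Space n × ℝ => 1 - p.2) (slab (Space n) 1) := by fun_prop
  exact (hsub.rpow_const_of_ne hne).smul <| hψ.contDiffOn.comp
    (contDiffOn_fst.prodMk (hsub.log hne).neg) fun p hp =>
      ⟨mem_univ _, neg_log_one_sub_nonneg hp.2⟩

theorem IsKleinGordonSolution.iteratedDeriv_two_conformalTransform
    (hψ : IsKleinGordonSolution A m φ₀ φ₁ ψ) (hκ : 2 * κ + 1 = n) (hm : m ^ 2 = κ * (κ + 1))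
    (x : Space n) {τ : ℝ} (hτ : τ ∈ Ioo 0 1) :
    iteratedDeriv 2 (conformalTransform κ ψ x) τ =
      A.apply (fun y => conformalTransform κ ψ y τ) x := by
  have hpos : 0 < 1 - τ := sub_pos.2 hτ.2
  have hslice : ContDiffAt ℝ 2 (ψ x) (-Real.log (1 - τ)) :=
    (hψ.contDiffOn.contDiffAt (prod_mem_nhds univ_mem (Ici_mem_nhds (neg_log_one_sub_pos hτ)))).comp
      _ (contDiffAt_const.prodMk contDiffAt_id)
  have hexp : Real.exp (-2 * -Real.log (1 - τ)) = (1 - τ) ^ 2 := by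
    rw [neg_mul_neg, mul_comm, ← Real.rpow_def_of_pos hpos, Real.rpow_two]
  have hpow : (1 - τ) ^ (-κ) = (1 - τ) ^ (-κ - 2) * (1 - τ) ^ 2 := by
    rw [← Real.rpow_two, ← Real.rpow_add hpos, sub_add_cancel]
  have hKG := hψ.equation x _ (neg_log_one_sub_pos hτ)
  have happly : A.apply (fun y => conformalTransform κ ψ y τ) x =
      (1 - τ) ^ (-κ) • A.apply (fun y => ψ y (-Real.log (1 - τ))) x :=
    congrFun (A.apply_const_smul ((1 - τ) ^ (-κ)) fun y => ψ y (-Real.log (1 - τ))) x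
  rw [happly, hpow, mul_smul]
  refine (iteratedDeriv_two_rpow_smul_comp_log κ hτ.2 hslice).trans ?_
  rw [hκ, ← hm]
  congr 1
  simp only [hexp, Complex.real_smul] at hKG ⊢
  push_cast at hKG ⊢
  linear_combination hKG

theorem IsKleinGordonSolution.isWaveOn (hψ : IsKleinGordonSolution A m φ₀ φ₁ ψ)
    (hκ : 2 * κ + 1 = n) (hm : m ^ 2 = κ * (κ + 1)) :
    IsWaveOn A 2 1 φ₀ (φ₁ + κ • φ₀) (conformalTransform κ ψ) where
  contDiffOn := hψ.contDiffOn_conformalTransform κ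
  equation x _ hτ := hψ.iteratedDeriv_two_conformalTransform hκ hm x hτ
  value x := by simp [conformalTransform, hψ.initial_value]
  velocity x := by
    have hvel : HasDerivWithinAt (ψ x) (φ₁ x) (Ici 0) (-Real.log (1 - 0)) := by
      simpa [hψ.initial_velocity x] using
        hasDerivWithinAt_slice_zero (hψ.contDiffOn.differentiableOn two_ne_zero) x
    have h := hasDerivWithinAt_rpow_smul_comp_log (-κ) one_pos hvel
      (s := Ico 0 1) fun σ hσ => neg_log_one_sub_nonneg hσ
    exact (h.mono_of_mem_nhdsWithin (Ico_mem_nhdsGE one_pos)).congr_deriv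
      (by simp [hψ.initial_value])

theorem IsKleinGordonSolution.eq_exp_rpow_smul (hψ : IsKleinGordonSolution A m φ₀ φ₁ ψ)
    (hκ : 2 * κ + 1 = n) (hm : m ^ 2 = κ * (κ + 1)) (hu : IsWaveOn A 2 1 φ₀ (φ₁ + κ • φ₀) u)
    (x : Space n) {t : ℝ} (ht : 0 ≤ t) :
    ψ x t = Real.exp (-t) ^ κ • u x (1 - Real.exp (-t)) := by
  have hpos := Real.exp_pos (-t)
  have h := (hψ.isWaveOn hκ hm).unique hu x (t := 1 - Real.exp (-t))
    ⟨by simpa using ht, sub_lt_self 1 hpos⟩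
  rw [conformalTransform, sub_sub_cancel, Real.log_exp, neg_neg] at h
  rw [← h, smul_smul, ← Real.rpow_add hpos, add_neg_cancel, Real.rpow_zero, one_smul]

end KleinGordon

section Superposition

variable {A : EllipticOperator n} {g₀ g₁ φ₀ φ₁ : Space n → ℂ} {u v₀ V₀ V₁ : Space n → ℝ → ℂ}

theorem IsWaveSolution.isWaveOn (hu : IsWaveSolution A g₀ g₁ u) (T : ℝ) :
    IsWaveOn A ∞ T g₀ g₁ u where
  contDiffOn := hu.smooth.mono (prod_mono_right Ico_subset_Ici_self)
  equation x t ht := sub_eq_zero.1 (hu.equation x t ht.1)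
  value := hu.initial_value
  velocity x := (hasDerivWithinAt_slice_zero (hu.smooth.differentiableOn (by simp)) x).congr_deriv
    (hu.initial_velocity x)

theorem isWaveOn_superposition (κ T : ℝ) (hv₀ : IsWaveSolution A φ₀ 0 v₀)
    (hV₀ : IsWaveSolution A 0 φ₀ V₀) (hV₁ : IsWaveSolution A 0 φ₁ V₁) :
    IsWaveOn A ∞ T φ₀ (φ₁ + κ • φ₀) (v₀ + κ • V₀ + V₁) := by
  have h := ((hv₀.isWaveOn T).add ENat.LEInfty.out ((hV₀.isWaveOn T).const_smul κ)).add
    ENat.LEInfty.out (hV₁.isWaveOn T)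
  simpa [add_comm (κ • φ₀)] using h

end Superposition

/-! ### Taylor expansion at time one -/

theorem norm_sub_sum_iteratedDeriv_le {F : Type*} [NormedAddCommGroup F] [NormedSpace ℝ F]
    {f : ℝ → F} {a δ C z : ℝ} {N : ℕ} (hδ : 0 < δ)
    (hf : ∀ t ∈ Icc (a - δ) a, ContDiffAt ℝ (N + 1) f t)
    (hC : ∀ t ∈ Icc (a - δ) a, ‖iteratedDeriv (N + 1) f t‖ ≤ C) (hz : z ∈ Icc 0 δ) :
    ‖f (a - z) - ∑ k ∈ Finset.range (N + 1), ((k.factorial : ℝ)⁻¹ * (-z) ^ k) • iteratedDeriv k f a‖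
      ≤ C / N.factorial * z ^ (N + 1) := by
  have hmaps : ∀ s ∈ Icc 0 δ, a - s ∈ Icc (a - δ) a := fun s hs =>
    ⟨sub_le_sub_left hs.2 a, sub_le_self a hs.1⟩
  have hreflect : ∀ s ∈ Icc 0 δ, ContDiffAt ℝ (N + 1) (fun s => f (a - s)) s := fun s hs =>
    (hf _ (hmaps s hs)).comp s (by fun_prop)
  have hderiv : ∀ k ≤ N + 1, ∀ s ∈ Icc 0 δ,
      iteratedDerivWithin k (fun s => f (a - s)) (Icc 0 δ) s =
        (-1 : ℝ) ^ k • iteratedDeriv k f (a - s) := fun k hk s hs => by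
    rw [iteratedDerivWithin_eq_iteratedDeriv (uniqueDiffOn_Icc hδ)
      ((hreflect s hs).of_le (mod_cast hk)) hs, iteratedDeriv_comp_const_sub]
  have hTaylor := taylor_mean_remainder_bound hδ.le
    (fun s hs => (hreflect s hs).contDiffWithinAt) hz fun s hs => by
      rw [hderiv _ le_rfl s hs, norm_smul, norm_pow, norm_neg, norm_one, one_pow, one_mul]
      exact hC _ (hmaps s hs)
  rw [taylor_within_apply, sub_zero, ← div_mul_eq_mul_div] at hTaylor
  convert hTaylor using 4 with k hk
  rw [hderiv k (Finset.mem_range_le hk) 0 ⟨le_rfl, hδ.le⟩, smul_smul, sub_zero, mul_assoc,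
    ← mul_pow, mul_neg_one]

theorem contDiffOn_iteratedDeriv_slice_time {E F : Type*} [NormedAddCommGroup E] [NormedSpace ℝ E]
    [NormedAddCommGroup F] [NormedSpace ℝ F] {f : E × ℝ → F} {Ω : Set (E × ℝ)} (hΩ : IsOpen Ω)
    (hf : ContDiffOn ℝ ∞ f Ω) (k : ℕ) :
    ContDiffOn ℝ ∞ (fun p => iteratedDeriv k (fun s => f (p.1, s)) p.2) Ω := by
  induction k with
  | zero => simpa using hf
  | succ k ih =>
    refine ((ih.fderiv_of_isOpen (m := ∞) hΩ (by simp)).clm_apply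
      (contDiffOn_const (c := ((0, 1) : E × ℝ)))).congr fun p hp => ?_
    rw [iteratedDeriv_succ]
    exact (hasDerivAt_slice_time
      ((ih.differentiableOn (by simp)).differentiableAt (hΩ.mem_nhds hp))).deriv

namespace IsWaveOn

variable {A : EllipticOperator n} {T : ℝ} {g₀ g₁ : Space n → ℂ} {u v : Space n → ℝ → ℂ}

theorem exists_norm_iteratedDeriv_le (hu : IsWaveOn A ∞ T g₀ g₁ u) (h₀ : HasCompactSupport g₀)
    (h₁ : HasCompactSupport g₁) {I : Set ℝ} (hI : IsCompact I) (hIT : I ⊆ Ioo 0 T) (k : ℕ) :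
    ∃ C, ∀ x, ∀ t ∈ I, ‖iteratedDeriv k (u x) t‖ ≤ C := by
  obtain ⟨R, hR⟩ := (hu.mono ENat.LEInfty.out le_rfl).exists_forall_eq_zero_of_lt_norm h₀ h₁
  have hcont := (contDiffOn_iteratedDeriv_slice_time (isOpen_univ.prod isOpen_Ioo)
    (hu.contDiffOn.mono (prod_mono_right Ioo_subset_Ico_self)) k).continuousOn
  obtain ⟨C, hC⟩ := ((isCompact_closedBall (0 : Space n) R).prod hI).exists_bound_of_continuousOn
    (hcont.mono (prod_mono (subset_univ _) hIT))
  refine ⟨max C 0, fun x t ht => ?_⟩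
  by_cases hx : ‖x‖ ≤ R
  · exact (hC (x, t) ⟨mem_closedBall_zero_iff.2 hx, ht⟩).trans (le_max_left C 0)
  · have hzero : u x =ᶠ[𝓝 t] fun _ => 0 := by
      filter_upwards [Ico_mem_nhds (hIT ht).1 (hIT ht).2] with s hs
      exact hR x (not_le.1 hx) s hs
    rw [hzero.iteratedDeriv_eq]
    simp

theorem exists_norm_sub_sum_taylorCoeff_le (hu : IsWaveOn A ∞ T g₀ g₁ u) (hT : 1 < T)
    (h₀ : HasCompactSupport g₀) (h₁ : HasCompactSupport g₁) (N : ℕ) :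
    ∃ C, ∀ x, ∀ z ∈ Icc (0 : ℝ) (1 / 2),
      ‖u x (1 - z) - ∑ k ∈ Finset.range (N + 1), taylorCoeff u k x * (z : ℂ) ^ k‖
        ≤ C * z ^ (N + 1) := by
  have hIT : Icc (1 - 1 / 2) 1 ⊆ Ioo 0 T := Icc_subset_Ioo (by norm_num) hT
  obtain ⟨C, hC⟩ := hu.exists_norm_iteratedDeriv_le h₀ h₁ isCompact_Icc hIT (N + 1)
  refine ⟨C / N.factorial, fun x z hz => ?_⟩
  have hTaylor := norm_sub_sum_iteratedDeriv_le one_half_pos (f := u x)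
    (fun t ht => contDiffAt_infty.1 (hu.contDiffAt_time x (hIT ht)) (N + 1)) (hC x) hz
  have hterm : ∀ k, ((k.factorial : ℝ)⁻¹ * (-z) ^ k) • iteratedDeriv k (u x) 1 =
      taylorCoeff u k x * (z : ℂ) ^ k := fun k => by
    rw [taylorCoeff, Complex.real_smul, neg_pow]
    push_cast
    ring
  simpa only [hterm] using hTaylor

theorem taylorCoeff_unique (hu : IsWaveOn A 2 T g₀ g₁ u) (hv : IsWaveOn A 2 T g₀ g₁ v)
    (hT : 1 < T) : taylorCoeff u = taylorCoeff v := by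
  funext k x
  have h : u x =ᶠ[𝓝 1] v x := by
    filter_upwards [Ico_mem_nhds one_pos hT] with t ht
    exact hu.unique hv x ht
  rw [taylorCoeff, taylorCoeff, h.iteratedDeriv_eq]

end IsWaveOn

theorem EllipticOperator.exists_norm_sub_sum_taylorCoeff_le (A : EllipticOperator n) {T : ℝ}
    (hT : 1 < T) {g₀ g₁ : Space n → ℂ} (h₀ : HasCompactSupport g₀) (h₁ : HasCompactSupport g₁)
    (N : ℕ) :
    ∃ C, ∀ u, IsWaveOn A ∞ T g₀ g₁ u → ∀ x, ∀ z ∈ Icc (0 : ℝ) (1 / 2),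
      ‖u x (1 - z) - ∑ k ∈ Finset.range (N + 1), taylorCoeff u k x * (z : ℂ) ^ k‖
        ≤ C * z ^ (N + 1) := by
  by_cases h : ∃ w, IsWaveOn A ∞ T g₀ g₁ w
  · obtain ⟨w, hw⟩ := h
    obtain ⟨C, hC⟩ := hw.exists_norm_sub_sum_taylorCoeff_le hT h₀ h₁ N
    refine ⟨C, fun u hu x z hz => ?_⟩
    have hu₂ : IsWaveOn A 2 T g₀ g₁ u := hu.mono ENat.LEInfty.out le_rfl
    have hw₂ : IsWaveOn A 2 T g₀ g₁ w := hw.mono ENat.LEInfty.out le_rfl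
    rw [hu₂.unique hw₂ x ⟨by linarith [hz.2], by linarith [hz.1]⟩, hu₂.taylorCoeff_unique hw₂ hT]
    exact hC x z hz
  · exact ⟨0, fun u hu => absurd ⟨u, hu⟩ h⟩

/-! ### The asymptotic expansion -/

section Asymptotics

variable {u v v₀ V₀ V₁ : Space n → ℝ → ℂ} {k N : ℕ} {x : Space n}

theorem taylorCoeff_add (hu : ContDiffAt ℝ k (u x) 1) (hv : ContDiffAt ℝ k (v x) 1) :
    taylorCoeff (u + v) k x = taylorCoeff u k x + taylorCoeff v k x := by
  rw [taylorCoeff, taylorCoeff, taylorCoeff, ← mul_add, ← iteratedDeriv_fun_add hu hv]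
  rfl

theorem taylorCoeff_const_smul (c : ℝ) (u : Space n → ℝ → ℂ) (k : ℕ) (x : Space n) :
    taylorCoeff (c • u) k x = c • taylorCoeff u k x := by
  rw [taylorCoeff, taylorCoeff, ← mul_smul_comm, ← iteratedDeriv_fun_const_smul_field]
  rfl

theorem psiAsympt_eq_rpow_smul_sum {κ z : ℝ} (hκ : 2 * κ + 1 = n) (hz : 0 ≤ z)
    (hv₀ : ContDiffAt ℝ ∞ (v₀ x) 1) (hV₀ : ContDiffAt ℝ ∞ (V₀ x) 1)
    (hV₁ : ContDiffAt ℝ ∞ (V₁ x) 1) :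
    psiAsympt v₀ V₀ V₁ N x z =
      z ^ κ • ∑ k ∈ Finset.range N, taylorCoeff (v₀ + κ • V₀ + V₁) k x * (z : ℂ) ^ k := by
  have hκ' : ((n : ℂ) - 1) / 2 = κ := by
    rw [← Complex.ofReal_natCast, ← hκ]
    push_cast
    ring
  have hcoeff : ∀ k, taylorCoeff (v₀ + κ • V₀ + V₁) k x =
      taylorCoeff v₀ k x + κ * taylorCoeff V₀ k x + taylorCoeff V₁ k x := fun k => by
    have hκV₀ : ContDiffAt ℝ k ((κ • V₀) x) 1 := (contDiffAt_infty.1 hV₀ k).const_smul κ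
    have hv₀' : ContDiffAt ℝ k (v₀ x) 1 := contDiffAt_infty.1 hv₀ k
    rw [taylorCoeff_add (hv₀'.add hκV₀) (contDiffAt_infty.1 hV₁ k), taylorCoeff_add hv₀' hκV₀,
      taylorCoeff_const_smul, Complex.real_smul]
  simp only [psiAsympt, hκ', hcoeff, Complex.real_smul, Complex.ofReal_cpow hz, add_mul,
    Finset.sum_add_distrib, Finset.mul_sum, mul_add, mul_assoc]

theorem IsKleinGordonSolution.sub_psiAsympt_eq {A : EllipticOperator n} {m κ t : ℝ}
    {φ₀ φ₁ : Space n → ℂ} {ψ : Space n → ℝ → ℂ} (hψ : IsKleinGordonSolution A m φ₀ φ₁ ψ)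
    (hκ : 2 * κ + 1 = n) (hm : m ^ 2 = κ * (κ + 1)) (hv₀ : IsWaveSolution A φ₀ 0 v₀)
    (hV₀ : IsWaveSolution A 0 φ₀ V₀) (hV₁ : IsWaveSolution A 0 φ₁ V₁) (ht : 0 ≤ t) :
    ψ x t - psiAsympt v₀ V₀ V₁ N x (Real.exp (-t)) =
      Real.exp (-t) ^ κ • ((v₀ + κ • V₀ + V₁) x (1 - Real.exp (-t))
        - ∑ k ∈ Finset.range N, taylorCoeff (v₀ + κ • V₀ + V₁) k x * (Real.exp (-t) : ℂ) ^ k) := by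
  have hsmooth {g₀ g₁ : Space n → ℂ} {u : Space n → ℝ → ℂ} (hu : IsWaveSolution A g₀ g₁ u) :
      ContDiffAt ℝ ∞ (u x) 1 := (hu.isWaveOn 2).contDiffAt_time x ⟨one_pos, one_lt_two⟩
  have hu : IsWaveOn A 2 1 φ₀ (φ₁ + κ • φ₀) (v₀ + κ • V₀ + V₁) :=
    (isWaveOn_superposition κ 1 hv₀ hV₀ hV₁).mono ENat.LEInfty.out le_rfl
  rw [hψ.eq_exp_rpow_smul hκ hm hu x ht, psiAsympt_eq_rpow_smul_sum hκ (Real.exp_nonneg _)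
    (hsmooth hv₀) (hsmooth hV₀) (hsmooth hV₁), smul_sub]

end Asymptotics

end DeSitter

open DeSitter

theorem mainTheorem10 (n : ℕ) (hn : 1 ≤ n) (A : DeSitter.EllipticOperator n)
    (m : ℝ) (hm : m = Real.sqrt ((n : ℝ) ^ 2 - 1) / 2)
    (φ₀ φ₁ : DeSitter.Space n → ℂ)
    (hφ₀ : DeSitter.IsTestFunction φ₀) (hφ₁ : DeSitter.IsTestFunction φ₁)
    (N : ℕ) (hN : 1 ≤ N) :
    ∃ C T : ℝ, ∀ v₀ V₀ V₁ ψ : DeSitter.Space n → ℝ → ℂ,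
      DeSitter.IsWaveSolution A φ₀ 0 v₀ →
      DeSitter.IsWaveSolution A 0 φ₀ V₀ →
      DeSitter.IsWaveSolution A 0 φ₁ V₁ →
      DeSitter.IsKleinGordonSolution A m φ₀ φ₁ ψ →
      ∀ t : ℝ, T ≤ t →
        MeasureTheory.eLpNorm
            (fun x => ψ x t - DeSitter.psiAsympt v₀ V₀ V₁ N x (Real.exp (-t) : ℂ))
            ⊤ MeasureTheory.volume
          ≤ ENNReal.ofReal (C * Real.exp (-(N : ℝ) * t - ((n : ℝ) - 1) / 2 * t)) := by
  obtain ⟨N, rfl⟩ := Nat.exists_eq_add_of_le' hN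
  set κ : ℝ := ((n : ℝ) - 1) / 2 with hκ_def
  have hκ : 2 * κ + 1 = n := by rw [hκ_def]; ring
  have hmκ : m ^ 2 = κ * (κ + 1) := by
    rw [hm, div_pow, Real.sq_sqrt (sub_nonneg.2 (one_le_pow₀ (Nat.one_le_cast.2 hn))), hκ_def]
    ring
  obtain ⟨C, hC⟩ := A.exists_norm_sub_sum_taylorCoeff_le one_lt_two hφ₀.2
    (hφ₁.2.add (hφ₀.2.smul_left (f := fun _ => κ))) N
  refine ⟨C, Real.log 2, fun v₀ V₀ V₁ ψ hv₀ hV₀ hV₁ hψ t ht => ?_⟩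
  have ht₀ : 0 ≤ t := (Real.log_nonneg one_le_two).trans ht
  have hz : Real.exp (-t) ≤ 1 / 2 := by
    rwa [one_div, ← Real.le_log_iff_exp_le (by norm_num), Real.log_inv, neg_le_neg_iff]
  have hTaylor := hC _ (isWaveOn_superposition κ 2 hv₀ hV₀ hV₁)
  rw [MeasureTheory.eLpNorm_exponent_top]
  refine MeasureTheory.eLpNormEssSup_le_of_ae_bound (.of_forall fun x => ?_)
  rw [hψ.sub_psiAsympt_eq hκ hmκ hv₀ hV₀ hV₁ ht₀, norm_smul, Real.norm_of_nonneg (by positivity)]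
  calc Real.exp (-t) ^ κ * _ ≤ Real.exp (-t) ^ κ * (C * Real.exp (-t) ^ (N + 1)) := by
        gcongr
        exact hTaylor x _ ⟨Real.exp_nonneg _, hz⟩
    _ = C * Real.exp (-↑(N + 1) * t - κ * t) := by
        rw [← Real.exp_mul, ← Real.exp_nat_mul, mul_left_comm, ← Real.exp_add]
        ring_nf
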